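/- Let $R$ be either (a) a noetherian commutative local ring with maximal ideal $\mathfrak m$, or (b) a noetherian commutative standard graded ring over a field $K$, i.e. $R=\bigoplus_{n\ge 0}R_n$ with $R_0=K$ and $R$ generated by $R_1$ as a $K$-algebra, with $\mathfrak m=\bigoplus_{n\ge 1}R_n$. Let $\mathcal I,\mathcal J\subsetneq R$ be proper ideals, homogeneous in case (b), which are Tor-independent, i.e. $\operatorname{Tor}^R_i(R/\mathcal I,R/\mathcal J)=0$ for all $i\ge 1$. For a finitely generated (in case (b): graded) $R$-module $M$, let $\beta^R_i(M)$ denote the rank of the $i$-th free module in a minimal (in case (b): minimal graded) free resolution of $M$ by free modules of finite rank, where minimal means that every differential has image in $\mathfrak m$ times its target. In case (b), let $\beta^R_{i,j}(M)$ denote the number of summands $R(-j)$ in the $i$-th module of a minimal graded free resolution. Then for all $\ell>0$ $$\beta_\ell^R(R/\mathcal I\mathcal J)=\sum_{i=1}^{\ell}\beta_i^R(R/\mathcal I)\,\beta_{\ell+1-i}^R(R/\mathcal J),$$ and in case (b), for all $\ell>0$ and $k\ge 0$, $$\beta_{\ell,k}^R(R/\mathcal I\mathcal J)=\sum_{i=1}^{\ell}\sum_{j=0}^{k}\beta_{i,j}^R(R/\mathcal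 I)\,\beta_{\ell+1-i,\,k-j}^R(R/\mathcal J).$$ -/

import Mathlib

open CategoryTheory

universe u v w

/-- A resolution `⋯ → R ^ b₂ → R ^ b₁ → R ^ b₀ → M → 0` of an `R`-module `M` by free modules of
finite rank: `rank i` is `bᵢ`, `d i` is the differential `R ^ bᵢ₊₁ → R ^ bᵢ` and `ε` is the
augmentation. -/
structure FreeResolution (R : Type u) [CommRing R] (M : Type w) [AddCommGroup M] [Module R M] where
  rank : ℕ → ℕ
  d : ∀ i : ℕ, (Fin (rank (i + 1)) → R) →ₗ[R] (Fin (rank i) → R)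
  ε : (Fin (rank 0) → R) →ₗ[R] M
  surjective : Function.Surjective ε
  exact_zero : Function.Exact (d 0) ε
  exact_succ : ∀ i : ℕ, Function.Exact (d (i + 1)) (d i)

namespace FreeResolution

variable {R : Type u} [CommRing R] {M : Type w} [AddCommGroup M] [Module R M]

/-- Minimality with respect to an ideal `𝔪`: the image of every differential lies in `𝔪 F`. -/
def IsMinimal (F : FreeResolution R M) (𝔪 : Ideal R) : Prop :=
  ∀ i : ℕ, LinearMap.range (F.d i) ≤ 𝔪 • (⊤ : Submodule R (Fin (F.rank i) → R))

end FreeResolution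

/-- Let `R` be graded by `𝒜`. The vector `x ∈ R ^ n` is homogeneous of degree `m` in the graded
free module `⨁ r, R(-deg r)`, whose `r`-th basis vector has degree `deg r`: the `r`-th coordinate
is homogeneous of degree `m - deg r`, which means that it is zero if `m < deg r`. -/
def IsHomogeneousVector {K : Type v} [Field K] {R : Type u} [CommRing R] [Algebra K R]
    (𝒜 : ℕ → Submodule K R) {n : ℕ} (deg : Fin n → ℕ) (m : ℕ) (x : Fin n → R) : Prop :=
  ∀ r : Fin n, x r = 0 ∨ ∃ a : ℕ, a + deg r = m ∧ x r ∈ 𝒜 a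

/-- `F` is a graded free resolution of the graded module `M = ⨁ ℳ m` when the `r`-th basis vector
of its `i`-th module is given the degree `deg i r`: all the differentials and the augmentation are
homogeneous of degree `0`. -/
structure FreeResolution.IsGraded {K : Type v} [Field K] {R : Type u} [CommRing R] [Algebra K R]
    {M : Type w} [AddCommGroup M] [Module R M] [Module K M]
    (F : FreeResolution R M) (𝒜 : ℕ → Submodule K R) (ℳ : ℕ → Submodule K M)
    (deg : ∀ i : ℕ, Fin (F.rank i) → ℕ) : Prop where
  d_homogeneous : ∀ (i : ℕ) (c : Fin (F.rank (i + 1))),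
    IsHomogeneousVector 𝒜 (deg i) (deg (i + 1) c) (F.d i (Pi.single c 1))
  ε_homogeneous : ∀ c : Fin (F.rank 0), F.ε (Pi.single c 1) ∈ ℳ (deg 0 c)

/-- The `i`-th Betti number of a finitely generated module over a noetherian local ring: the rank
of the `i`-th module in a minimal free resolution. (A minimal free resolution exists and its ranks
are unique, so that the set below has exactly one element.) -/
noncomputable def localBetti (R : Type u) [CommRing R] [IsLocalRing R]
    (M : Type w) [AddCommGroup M] [Module R M] (i : ℕ) : ℕ :=
  sInf {b : ℕ | ∃ F : FreeResolution R M,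
    F.IsMinimal (IsLocalRing.maximalIdeal R) ∧ F.rank i = b}

/-- A graded `K`-algebra `R = ⨁ 𝒜 n` is standard graded if `𝒜 0 = K` and `R` is generated over `K`
by elements of degree one. -/
structure IsStandardGraded {K : Type v} [Field K] {R : Type u} [CommRing R] [Algebra K R]
    (𝒜 : ℕ → Submodule K R) : Prop where
  injective : Function.Injective (algebraMap K R)
  degree_zero : (𝒜 0 : Set R) = Set.range (algebraMap K R)
  generated : Algebra.adjoin K (𝒜 1 : Set R) = ⊤

section Graded

variable {K : Type v} [Field K] {R : Type u} [CommRing R] [Algebra K R]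
  (𝒜 : ℕ → Submodule K R) [GradedAlgebra 𝒜]
  {M : Type w} [AddCommGroup M] [Module R M] [Module K M] (ℳ : ℕ → Submodule K M)

/-- The `i`-th Betti number of a finitely generated graded module over a noetherian standard
graded ring: the rank of the `i`-th module in a minimal graded free resolution. (Again the set
below has exactly one element.) -/
noncomputable def totalBetti (i : ℕ) : ℕ :=
  sInf {b : ℕ | ∃ (F : FreeResolution R M) (deg : ∀ i : ℕ, Fin (F.rank i) → ℕ),
    F.IsGraded 𝒜 ℳ deg ∧ F.IsMinimal (HomogeneousIdeal.irrelevant 𝒜).toIdeal ∧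
      F.rank i = b}

/-- The graded Betti number in homological degree `i` and internal degree `j`: the number of
summands `R(-j)` of the `i`-th module in a minimal graded free resolution. (Again the set below has
exactly one element.) -/
noncomputable def gradedBetti (i j : ℕ) : ℕ :=
  sInf {b : ℕ | ∃ (F : FreeResolution R M) (deg : ∀ i : ℕ, Fin (F.rank i) → ℕ),
    F.IsGraded 𝒜 ℳ deg ∧ F.IsMinimal (HomogeneousIdeal.irrelevant 𝒜).toIdeal ∧
      (Finset.univ.filter fun r : Fin (F.rank i) => deg i r = j).card = b}

end Graded

/-- The graded pieces of `R ⧸ I`: the images of those of `R`. -/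
def quotientGrading {K : Type v} [Field K] {R : Type u} [CommRing R] [Algebra K R]
    (𝒜 : ℕ → Submodule K R) (I : Ideal R) (n : ℕ) : Submodule K (R ⧸ I) :=
  (𝒜 n).map (Ideal.Quotient.mkₐ K I).toLinearMap

/-- `M` and `N` are Tor-independent: `Tor_i(M, N) = 0` for all `i ≥ 1`. -/
def TorIndependent (R : Type u) [CommRing R] (M N : Type u) [AddCommGroup M] [Module R M]
    [AddCommGroup N] [Module R N] : Prop :=
  ∀ i : ℕ, 1 ≤ i →
    Limits.IsZero (((Tor (ModuleCat.{u} R) i).obj (ModuleCat.of R M)).obj (ModuleCat.of R N))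

/-- The ideals `I` and `J` are Tor-independent if `R ⧸ I` and `R ⧸ J` are. -/
def Ideal.TorIndependent {R : Type u} [CommRing R] (I J : Ideal R) : Prop :=
  _root_.TorIndependent R (R ⧸ I) (R ⧸ J)

open Finset Matrix TensorProduct

/-! Let `F` and `G` be minimal resolutions of R/J and R/I. Without their modules in degree 0 they
resolve J and I, so the double complex F_{i+1} ⊗ G_{j+1} computes Tor(J, I). By dimension shifting
Tor_n(J, I) = Tor_{n+2}(R/J, R/I) for n ≥ 1, and the kernel of J ⊗ I → JI is Tor_2(R/J, R/I).
Tor-independence kills all of these, so the total complex resolves JI. Splicing with JI ⊆ R gives a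
resolution of R/JI whose module in degree ℓ ≥ 1 is the sum of F_a ⊗ G_b over a, b ≥ 1 with a + b = ℓ
+ 1. It is minimal because `F` and `G` are, and counting its basis vectors, with their degrees,
yields the formulas.

`CyclicResolution.isExactMod` turns the vanishing of Tor into exactness of F ⊗ R/I,
`IsExactMod.exists_familyD_eq` deduces exactness of the total complex by explicit corrections, and
`IsMinimalHom.total` gives minimality. The Betti numbers are read off any minimal resolution thanks
to `FreeResolution.IsMinimalHom.card_eq`: a chain endomorphism lifting the identity is the identity
modulo 𝔪. -/

/-- A bookkeeping device that treats noetherian local rings and positively graded algebras over a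
field uniformly. `hom a b` consists of the entries that a homogeneous matrix may have in a row
of degree `a` and a column of degree `b`, and `π a b` projects to these. -/
structure EntryGrading (R : Type u) [CommRing R] (𝔪 : Ideal R) where
  hom : ℕ → ℕ → AddSubgroup R
  π : ℕ → ℕ → R →+ R
  one_mem : ∀ a, 1 ∈ hom a a
  mul_mem : ∀ {a b c x y}, x ∈ hom a b → y ∈ hom b c → x * y ∈ hom a c
  add_right_mem : ∀ {a b x} c, x ∈ hom a b → x ∈ hom (a + c) (b + c)
  π_mem : ∀ a b x, π a b x ∈ hom a b
  π_of_mem : ∀ {a b x}, x ∈ hom a b → π a b x = x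
  π_mul : ∀ {a b x} c y, x ∈ hom a b → π a c (x * y) = x * π b c y
  sum_π : ∀ a x, ∃ N, ∀ n ≥ N, ∑ m ∈ range n, π a m x = x
  mem_of_ne : ∀ {a b x}, a ≠ b → x ∈ hom a b → x ∈ 𝔪
  isUnit_π : ∀ {x} a, x ∉ 𝔪 → IsUnit (π a a x)

/-! ### Homogeneous matrices and minimal homogeneous generators -/

namespace EntryGrading

variable {R : Type u} [CommRing R] {𝔪 : Ideal R} (H : EntryGrading R 𝔪)
  {ι κ : Type*}

/-- The homogeneous vectors of degree `m` of a graded free module. -/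
def IsHomVec (deg : ι → ℕ) (m : ℕ) (x : ι → R) : Prop := ∀ r, x r ∈ H.hom (deg r) m

/-- The homogeneous matrices. -/
def IsHomMat (deg : ι → ℕ) (deg' : κ → ℕ) (D : Matrix ι κ R) : Prop :=
  ∀ r c, D r c ∈ H.hom (deg r) (deg' c)

/-- The homogeneous component of degree `m` of a vector. -/
def proj (deg : ι → ℕ) (m : ℕ) (x : ι → R) : ι → R := fun r => H.π (deg r) m (x r)

variable {H} {deg : ι → ℕ} {deg' : κ → ℕ} {m : ℕ}

theorem isHomVec_proj (x : ι → R) : H.IsHomVec deg m (H.proj deg m x) := fun _ => H.π_mem _ _ _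

theorem IsHomVec.proj_eq {x : ι → R} (hx : H.IsHomVec deg m x) : H.proj deg m x = x :=
  funext fun r => H.π_of_mem (hx r)

theorem IsHomMat.proj_mulVec [Fintype κ] {D : Matrix ι κ R} (hD : H.IsHomMat deg deg' D)
    (m : ℕ) (y : κ → R) : H.proj deg m (D *ᵥ y) = D *ᵥ H.proj deg' m y := by
  ext r
  simp only [proj, mulVec, dotProduct, map_sum]
  exact sum_congr rfl fun c _ => H.π_mul m _ (hD r c)

theorem IsHomMat.mulVec [Fintype κ] {D : Matrix ι κ R} (hD : H.IsHomMat deg deg' D)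
    {y : κ → R} (hy : H.IsHomVec deg' m y) : H.IsHomVec deg m (D *ᵥ y) := fun r =>
  AddSubgroup.sum_mem _ fun c _ => H.mul_mem (hD r c) (hy c)

theorem isHomVec_single [DecidableEq ι] (r : ι) :
    H.IsHomVec deg (deg r) (Pi.single r (1 : R)) := by
  intro s
  rcases eq_or_ne s r with rfl | h
  · simpa using H.one_mem _
  · simp [h]

theorem sum_proj [Fintype ι] (x : ι → R) : ∃ N, ∑ m ∈ range N, H.proj deg m x = x := by
  choose N hN using fun r => H.sum_π (deg r) (x r)
  refine ⟨univ.sup N, funext fun r => ?_⟩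
  rw [Finset.sum_apply]
  exact hN r _ (le_sup (mem_univ r))

/-- A homogeneous submodule of a graded free module. -/
def IsHomSubmodule (H : EntryGrading R 𝔪) (deg : ι → ℕ) (N : Submodule R (ι → R)) : Prop :=
  ∀ x ∈ N, ∀ m, H.proj deg m x ∈ N

theorem IsHomMat.isHomSubmodule_ker [Fintype κ] {D : Matrix ι κ R} (hD : H.IsHomMat deg deg' D) :
    H.IsHomSubmodule deg' (LinearMap.ker D.mulVecLin) := by
  intro x hx m
  rw [LinearMap.mem_ker, mulVecLin_apply] at hx ⊢
  rw [← hD.proj_mulVec, hx]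
  ext r
  simp [proj]

/-- Homogeneous generators of a homogeneous submodule, with the relations in `𝔪`. -/
theorem IsHomSubmodule.exists_minimal_generators [Fintype ι] [IsNoetherianRing R]
    {N : Submodule R (ι → R)} (hN : H.IsHomSubmodule deg N) :
    ∃ (k : ℕ) (deg' : Fin k → ℕ) (D : Matrix ι (Fin k) R), H.IsHomMat deg deg' D ∧
      LinearMap.range D.mulVecLin = N ∧ ∀ y, D *ᵥ y = 0 → ∀ c, y c ∈ 𝔪 := by
  classical
  let P : ℕ → Prop := fun k => ∃ (deg' : Fin k → ℕ) (D : Matrix ι (Fin k) R),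
    H.IsHomMat deg deg' D ∧ Submodule.span R (Set.range D.col) = N
  have hP : ∃ k, P k := by
    let S : Set (ι → R) := {x | x ∈ N ∧ ∃ m, H.IsHomVec deg m x}
    have hS : Submodule.span R S = N := by
      refine le_antisymm (Submodule.span_le.2 fun x hx => hx.1) fun x hx => ?_
      obtain ⟨n, hn⟩ := sum_proj (H := H) (deg := deg) x
      rw [← hn]
      exact Submodule.sum_mem _ fun m _ =>
        Submodule.subset_span ⟨hN x hx m, m, isHomVec_proj x⟩
    obtain ⟨T, hTS, hT⟩ := (Submodule.fg_span_iff_fg_span_finset_subset S).1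
      (hS ▸ IsNoetherian.noetherian N)
    let e := T.equivFin
    choose d hd using fun t : T => (hTS t.2).2
    refine ⟨#T, fun c => d (e.symm c), fun r c => (e.symm c).1 r,
      fun r c => hd (e.symm c) r, ?_⟩
    rw [← hS, hT]
    congr 1
    ext x
    constructor
    · rintro ⟨c, rfl⟩
      exact (e.symm c).2
    · intro hx
      exact ⟨e ⟨x, hx⟩, congrArg Subtype.val (e.symm_apply_apply ⟨x, hx⟩)⟩
  obtain ⟨k, ⟨deg', D, hD, hspan⟩, hmin⟩ : ∃ k, P k ∧ ∀ l < k, ¬ P l :=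
    ⟨Nat.find hP, Nat.find_spec hP, fun l hl => Nat.find_min hP hl⟩
  refine ⟨k, deg', D, hD, by rw [range_mulVecLin, hspan], fun y hy j => ?_⟩
  by_contra hj
  obtain _ | k := k
  · exact j.elim0
  refine hmin k (Nat.lt_succ_self k) ⟨deg' ∘ j.succAbove, D.submatrix id j.succAbove,
    fun r c => hD r _, ?_⟩
  -- The component of degree `deg' j` of the relation `y` is again a relation, and its `j`-th
  -- coefficient is a unit. Hence the `j`-th generator is redundant, against the minimality of the
  -- number of generators.
  have hu := H.isUnit_π (deg' j) hj
  have hz : D *ᵥ H.proj deg' (deg' j) y = 0 := by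
    rw [← hD.proj_mulVec, hy]
    ext r
    simp [proj]
  set z := H.proj deg' (deg' j) y with hzdef
  have hzj : IsUnit (z j) := hu
  have hcol : ∀ c, (D.submatrix id j.succAbove).col c = D.col (j.succAbove c) := fun c => rfl
  rw [← hspan]
  refine le_antisymm (Submodule.span_mono ?_) (Submodule.span_le.2 ?_)
  · rintro _ ⟨c, rfl⟩
    exact ⟨_, rfl⟩
  · rintro _ ⟨c, rfl⟩
    have hmem : ∀ c, D.col (j.succAbove c) ∈
        Submodule.span R (Set.range (D.submatrix id j.succAbove).col) := fun c =>
      Submodule.subset_span ⟨c, rfl⟩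
    rcases Fin.eq_self_or_eq_succAbove j c with rfl | ⟨c, rfl⟩
    · rw [mulVec_eq_sum, Fin.sum_univ_succAbove _ c] at hz
      have h1 : z c • D.col c = - ∑ i, z (c.succAbove i) • D.col (c.succAbove i) := by
        rw [eq_neg_iff_add_eq_zero, ← hz]
        ext r
        simp [Matrix.col]
      obtain ⟨w, hw⟩ := hzj.exists_left_inv
      have h2 : D.col c = w • (z c • D.col c) := by rw [smul_smul, hw, one_smul]
      rw [SetLike.mem_coe, h2, h1]
      exact Submodule.smul_mem _ _ (Submodule.neg_mem _
        (Submodule.sum_mem _ fun i _ => Submodule.smul_mem _ _ (hmem i)))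
    · exact hmem c

end EntryGrading

/-! ### Existence of minimal homogeneous resolutions -/

/-- A resolution of `R ⧸ I` by finite free modules, given by matrices, that starts with `R`. -/
structure CyclicResolution {R : Type u} [CommRing R] (I : Ideal R) where
  ι : ℕ → Type
  [fintype : ∀ i, Fintype (ι i)]
  [decidableEq : ∀ i, DecidableEq (ι i)]
  [unique : Unique (ι 0)]
  D : ∀ i, Matrix (ι i) (ι (i + 1)) R
  exact_zero : ∀ x : ι 0 → R, x default ∈ I ↔ ∃ y, D 0 *ᵥ y = x
  exact_succ : ∀ i (x : ι (i + 1) → R), D i *ᵥ x = 0 ↔ ∃ y, D (i + 1) *ᵥ y = x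

attribute [instance] CyclicResolution.fintype CyclicResolution.decidableEq CyclicResolution.unique

namespace CyclicResolution

variable {R : Type u} [CommRing R] {I : Ideal R} {𝔪 : Ideal R}

/-- A minimal resolution that is homogeneous for the degrees `deg`. -/
structure IsMinimalHom (F : CyclicResolution I) (H : EntryGrading R 𝔪)
    (deg : ∀ i, F.ι i → ℕ) : Prop where
  deg_zero : deg 0 default = 0
  hom : ∀ i, H.IsHomMat (deg i) (deg (i + 1)) (F.D i)
  mem : ∀ i r c, F.D i r c ∈ 𝔪

theorem mem_of_forall_mulVec_mem {ι κ : Type*} [Fintype κ] [DecidableEq κ] {D : Matrix ι κ R}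
    (h : ∀ y r, (D *ᵥ y) r ∈ 𝔪) (r : ι) (c : κ) : D r c ∈ 𝔪 := by
  simpa using h (Pi.single c 1) r

/-- A graded free module with a homogeneous submodule, the next syzygy to be covered. -/
structure SyzygyState (H : EntryGrading R 𝔪) where
  rank : ℕ
  deg : Fin rank → ℕ
  N : Submodule R (Fin rank → R)
  isHom : H.IsHomSubmodule deg N

theorem exists_isMinimalHom [IsNoetherianRing R] (H : EntryGrading R 𝔪) (hI : I ≤ 𝔪)
    (hhom : ∀ x ∈ I, ∀ m, H.π 0 m x ∈ I) :
    ∃ (F : CyclicResolution I) (deg : ∀ i, F.ι i → ℕ), F.IsMinimalHom H deg := by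
  choose k deg D hD hrange hmin using fun s : SyzygyState H => s.isHom.exists_minimal_generators
  let next : SyzygyState H → SyzygyState H := fun s =>
    ⟨k s, deg s, LinearMap.ker (D s).mulVecLin, (hD s).isHomSubmodule_ker⟩
  let s₀ : SyzygyState H := ⟨1, fun _ => 0, Submodule.comap (LinearMap.proj (R := R) (φ := fun _ : Fin 1 => R) 0) I,
    fun x hx m => hhom _ hx m⟩
  -- By this recursion the submodule covered at stage `i + 1` is definitionally the kernel of the
  -- `i`-th matrix, so both exactness fields are instances of `hr`.
  let s : ℕ → SyzygyState H := fun i => Nat.rec s₀ (fun _ => next) i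
  have hr : ∀ i x, x ∈ (s i).N ↔ ∃ y, D (s i) *ᵥ y = x := fun i x => by
    conv_lhs => rw [← hrange (s i)]
    rfl
  refine ⟨{ ι := fun i => Fin (s i).rank
            unique := inferInstanceAs (Unique (Fin 1))
            D := fun i => D (s i)
            exact_zero := fun x => hr 0 x
            exact_succ := fun i x => hr (i + 1) x }, fun i => (s i).deg, ⟨rfl, fun i => hD (s i), ?_⟩⟩
  intro i
  refine mem_of_forall_mulVec_mem fun y => ?_
  have hmem : D (s i) *ᵥ y ∈ (s i).N := (hr i _).2 ⟨y, rfl⟩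
  -- The first matrix has image `I ≤ 𝔪`; the image of a later one consists of relations between the
  -- minimal generators chosen one stage before.
  obtain _ | i := i
  · intro r
    rw [Subsingleton.elim (α := Fin 1) r 0]
    exact hI hmem
  · exact hmin (s i) _ hmem

end CyclicResolution

/-! ### Homogeneous lifts and comparison modulo 𝔪 -/

section Lifting

set_option linter.unusedSectionVars false

variable {R : Type u} [CommRing R] {𝔪 : Ideal R} {H : EntryGrading R 𝔪}
  {ι κ μ : Type*} [Fintype ι] [Fintype κ] [Fintype μ] [DecidableEq ι] [DecidableEq κ]
  [DecidableEq μ] {deg : ι → ℕ} {deg' : κ → ℕ} {deg'' : μ → ℕ}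

theorem LinearMap.exists_comp_eq {L M N : Type*} [AddCommGroup M] [Module R M] [AddCommGroup N]
    [Module R N] [AddCommGroup L] [Module R L] [Module.Projective R L] {d : M →ₗ[R] N}
    {g : L →ₗ[R] N} (h : ∀ x, ∃ y, d y = g x) : ∃ φ : L →ₗ[R] M, ∀ x, d (φ x) = g x := by
  obtain ⟨φ, hφ⟩ := Module.projective_lifting_property d.rangeRestrict
    (g.codRestrict (LinearMap.range d) h) d.surjective_rangeRestrict
  exact ⟨φ, fun x => congrArg Subtype.val (LinearMap.congr_fun hφ x)⟩

/-- A linear map of graded free modules is homogeneous of degree zero if its matrix is. -/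
def EntryGrading.IsHomLin (H : EntryGrading R 𝔪) (deg : ι → ℕ) (deg' : κ → ℕ)
    (f : (κ → R) →ₗ[R] (ι → R)) : Prop := H.IsHomMat deg deg' (LinearMap.toMatrix' f)

theorem EntryGrading.IsHomLin.proj_apply {f : (κ → R) →ₗ[R] (ι → R)}
    (hf : H.IsHomLin deg deg' f) (m : ℕ) (y : κ → R) :
    H.proj deg m (f y) = f (H.proj deg' m y) := by
  rw [← LinearMap.toMatrix'_mulVec f, ← LinearMap.toMatrix'_mulVec f, hf.proj_mulVec]

theorem EntryGrading.IsHomLin.apply {f : (κ → R) →ₗ[R] (ι → R)}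
    (hf : H.IsHomLin deg deg' f) {m : ℕ} {y : κ → R} (hy : H.IsHomVec deg' m y) :
    H.IsHomVec deg m (f y) := by
  rw [← LinearMap.toMatrix'_mulVec f]
  exact hf.mulVec hy

theorem EntryGrading.isHomLin_of_forall {f : (κ → R) →ₗ[R] (ι → R)}
    (hf : ∀ c, H.IsHomVec deg (deg' c) (f (Pi.single c 1))) : H.IsHomLin deg deg' f := by
  intro r c
  rw [LinearMap.toMatrix'_apply]
  exact hf c r

theorem EntryGrading.IsHomLin.comp {f : (κ → R) →ₗ[R] (ι → R)} {g : (μ → R) →ₗ[R] (κ → R)}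
    (hf : H.IsHomLin deg deg' f) (hg : H.IsHomLin deg' deg'' g) :
    H.IsHomLin deg deg'' (f ∘ₗ g) :=
  isHomLin_of_forall fun c => hf.apply (hg.apply (isHomVec_single c))

theorem exists_isHomLin_of_forall {M : Type*} [AddCommGroup M] [Module R M]
    {d : (κ → R) →ₗ[R] M} {g : (μ → R) →ₗ[R] M}
    (h : ∀ c, ∃ y, H.IsHomVec deg' (deg'' c) y ∧ d y = g (Pi.single c 1)) :
    ∃ φ : (μ → R) →ₗ[R] (κ → R), H.IsHomLin deg' deg'' φ ∧ ∀ x, d (φ x) = g x := by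
  choose y hy hyd using h
  have key : ∀ c, (Pi.basisFun R μ).constr R y (Pi.single c 1) = y c := fun c => by
    rw [← Pi.basisFun_apply R, Module.Basis.constr_basis]
  refine ⟨(Pi.basisFun R μ).constr R y, EntryGrading.isHomLin_of_forall fun c => ?_, fun x => ?_⟩
  · rw [key]
    exact hy c
  · refine LinearMap.congr_fun (f := d ∘ₗ _) ((Pi.basisFun R μ).ext fun c => ?_) x
    simp [key, hyd]

/-- It suffices to lift basis vectors. Any preimage of a homogeneous vector can be replaced by its
component of the same degree, as `d` commutes with taking components. -/
theorem EntryGrading.IsHomLin.exists_lift {d : (κ → R) →ₗ[R] (ι → R)} {g : (μ → R) →ₗ[R] (ι → R)}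
    (hd : H.IsHomLin deg deg' d) (hg : H.IsHomLin deg deg'' g) (h : ∀ x, ∃ y, d y = g x) :
    ∃ φ : (μ → R) →ₗ[R] (κ → R), H.IsHomLin deg' deg'' φ ∧ ∀ x, d (φ x) = g x := by
  refine exists_isHomLin_of_forall fun c => ?_
  obtain ⟨y, hy⟩ := h (Pi.single c 1)
  refine ⟨H.proj deg' (deg'' c) y, isHomVec_proj y, ?_⟩
  rw [← hd.proj_apply, hy]
  exact (hg.apply (isHomVec_single c)).proj_eq

theorem LinearMap.apply_mem_of_forall_mem (f : (κ → R) →ₗ[R] (ι → R)) {x : κ → R}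
    (hx : ∀ c, x c ∈ 𝔪) (r : ι) : f x r ∈ 𝔪 := by
  rw [← LinearMap.toMatrix'_mulVec f]
  exact Ideal.sum_mem _ fun c _ => Ideal.mul_mem_left _ _ (hx c)

/-- A homogeneous map with a left inverse modulo `𝔪` does not lower the number of basis vectors
with degrees in a given set. -/
theorem card_le_of_comp_eq_one_mod (h𝔪 : 𝔪 ≠ ⊤) {φ : (ι → R) →ₗ[R] (κ → R)}
    {ψ : (κ → R) →ₗ[R] (ι → R)} (hφ : H.IsHomLin deg' deg φ)
    (h : ∀ x r, (ψ (φ x) - x) r ∈ 𝔪) (P : ℕ → Prop) [DecidablePred P] :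
    Fintype.card {r // P (deg r)} ≤ Fintype.card {s // P (deg' s)} := by
  have : Nontrivial (R ⧸ 𝔪) := Ideal.Quotient.nontrivial_iff.2 h𝔪
  let A : Matrix {s // P (deg' s)} {r // P (deg r)} (R ⧸ 𝔪) :=
    fun s r => Ideal.Quotient.mk 𝔪 (LinearMap.toMatrix' φ s r)
  let B : Matrix {r // P (deg r)} {s // P (deg' s)} (R ⧸ 𝔪) :=
    fun r s => Ideal.Quotient.mk 𝔪 (LinearMap.toMatrix' ψ r s)
  have hBA : B * A = 1 := by
    ext r r'
    have h1 := Ideal.Quotient.eq.2 (h (Pi.single r'.1 1) r.1)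
    rw [← LinearMap.comp_apply, ← LinearMap.toMatrix'_apply, LinearMap.toMatrix'_comp,
      Matrix.mul_apply, map_sum, ← Fintype.sum_subtype_add_sum_subtype (fun s => P (deg' s))] at h1
    rw [Matrix.mul_apply]
    -- A degree satisfying `P` differs from one that does not, so these entries of `φ` lie in `𝔪`.
    -- Modulo `𝔪` the identity `ψ φ = 1` therefore restricts to the blocks cut out by `P`.
    have h2 : ∑ s : {s // ¬ P (deg' s)}, Ideal.Quotient.mk 𝔪
        (LinearMap.toMatrix' ψ r s * LinearMap.toMatrix' φ s r') = 0 := by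
      refine sum_eq_zero fun s _ => Ideal.Quotient.eq_zero_iff_mem.2 (Ideal.mul_mem_left _ _ ?_)
      refine H.mem_of_ne (fun h => s.2 ?_) (hφ s r')
      rw [h]
      exact r'.2
    rw [h2, add_zero] at h1
    simp only [A, B, ← map_mul]
    rw [h1, Matrix.one_apply, Pi.single_apply]
    simp only [Subtype.ext_iff]
    split_ifs <;> simp
  have hinj : Function.Injective A.mulVecLin := by
    intro x y hxy
    simp only [mulVecLin_apply] at hxy
    have := congrArg (B *ᵥ ·) hxy
    simpa [mulVec_mulVec, hBA] using this
  exact card_le_of_injective (R ⧸ 𝔪) _ hinj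

end Lifting

/-! ### Uniqueness of the ranks in a minimal resolution -/

namespace FreeResolution

variable {R : Type u} [CommRing R] {I 𝔪 : Ideal R} {H : EntryGrading R 𝔪}

/-- Minimal resolutions of `R ⧸ I` that are homogeneous for the degrees `deg`. -/
structure IsMinimalHom (F : FreeResolution R (R ⧸ I)) (H : EntryGrading R 𝔪)
    (deg : ∀ i, Fin (F.rank i) → ℕ) : Prop where
  hom : ∀ i, H.IsHomLin (deg i) (deg (i + 1)) (F.d i)
  ε_hom : ∀ c, ∃ x ∈ H.hom 0 (deg 0 c), F.ε (Pi.single c 1) = Ideal.Quotient.mk I x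
  mem : ∀ i x r, F.d i x r ∈ 𝔪

/-- A chain map lifting zero is null-homotopic, `χ = d h + h d`, and both terms have coordinates in
`𝔪` because `d` has. Applied to `ψ φ - 1`, this shows that comparison maps between minimal
resolutions are mutually inverse modulo `𝔪`. -/
theorem mem_of_comp_eq_zero {M : Type w} [AddCommGroup M] [Module R M] {F : FreeResolution R M}
    (hF : ∀ i x r, F.d i x r ∈ 𝔪)
    {χ : ∀ i, (Fin (F.rank i) → R) →ₗ[R] (Fin (F.rank i) → R)} (h₀ : ∀ x, F.ε (χ 0 x) = 0)
    (hχ : ∀ i x, F.d i (χ (i + 1) x) = χ i (F.d i x)) (i : ℕ) (x) (r) : χ i x r ∈ 𝔪 := by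
  -- The first clause is what the construction of the next homotopy needs; in the second, the term
  -- `h d` has been absorbed into `𝔪`.
  have key : ∀ i, ∃ h : (Fin (F.rank i) → R) →ₗ[R] (Fin (F.rank (i + 1)) → R),
      (∀ x, χ i (F.d i x) = F.d i (h (F.d i x))) ∧ ∀ x r, (χ i x - F.d i (h x)) r ∈ 𝔪 := by
    intro i
    induction i with
    | zero =>
      obtain ⟨h, hh⟩ := LinearMap.exists_comp_eq (d := F.d 0) (g := χ 0)
        fun x => (F.exact_zero _).1 (h₀ x)
      exact ⟨h, fun x => (hh _).symm, fun x r => by simp [hh]⟩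
    | succ i ih =>
      obtain ⟨h, h1, h2⟩ := ih
      obtain ⟨h', hh'⟩ := LinearMap.exists_comp_eq (d := F.d (i + 1)) (g := χ (i + 1) - h ∘ₗ F.d i)
        fun x => (F.exact_succ i _).1 (by simp [hχ, h1])
      refine ⟨h', fun x => ?_, fun x r => ?_⟩
      · simp [hh', (F.exact_succ i).apply_apply_eq_zero]
      · rw [hh']
        simpa using LinearMap.apply_mem_of_forall_mem h (hF i x) r
  obtain ⟨h, -, h2⟩ := key i
  simpa using Ideal.add_mem _ (h2 x r) (hF i (h x) r)

theorem IsMinimalHom.exists_map {F F' : FreeResolution R (R ⧸ I)}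
    {deg : ∀ i, Fin (F.rank i) → ℕ} {deg' : ∀ i, Fin (F'.rank i) → ℕ}
    (hI : ∀ x ∈ I, ∀ m, H.π 0 m x ∈ I)
    (hF : F.IsMinimalHom H deg) (hF' : F'.IsMinimalHom H deg') :
    ∃ φ : ∀ i, (Fin (F.rank i) → R) →ₗ[R] (Fin (F'.rank i) → R),
      (∀ i, H.IsHomLin (deg' i) (deg i) (φ i)) ∧ (∀ x, F'.ε (φ 0 x) = F.ε x) ∧
      ∀ i x, F'.d i (φ (i + 1) x) = φ i (F.d i x) := by
  -- Each lift carries the fact that its composite with the differential lands in the image of the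
  -- next one, so that the recursion needs only the latest map.
  let S : ℕ → Type _ := fun i => {φ : (Fin (F.rank i) → R) →ₗ[R] (Fin (F'.rank i) → R) //
    H.IsHomLin (deg' i) (deg i) φ ∧ ∀ x, ∃ y, F'.d i y = φ (F.d i x)}
  have base : ∃ φ : S 0, ∀ x, F'.ε (φ.1 x) = F.ε x := by
    choose a ha haε using hF'.ε_hom
    have hε : ∀ y, F'.ε y = Ideal.Quotient.mk I (∑ r, a r * y r) := fun y => by
      conv_lhs => rw [pi_eq_sum_univ' y]
      simp only [map_sum, map_smul, map_mul]
      refine sum_congr rfl fun r _ => ?_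
      rw [haε, mul_comm]
      rfl
    obtain ⟨φ, hφ, hφε⟩ := exists_isHomLin_of_forall (H := H) (deg' := deg' 0) (deg'' := deg 0)
      (d := F'.ε) (g := F.ε) fun c => by
        obtain ⟨x, hx, hxε⟩ := hF.ε_hom c
        obtain ⟨y, hy⟩ := F'.surjective (F.ε (Pi.single c 1))
        -- Passing to the component of degree `deg 0 c` keeps the image unchanged: the discrepancy
        -- of `y` lies in `I`, which is stable under `π 0 m`.
        refine ⟨H.proj (deg' 0) (deg 0 c) y, EntryGrading.isHomVec_proj y, ?_⟩
        have h1 : ∑ r, a r * H.proj (deg' 0) (deg 0 c) y r = H.π 0 (deg 0 c) (∑ r, a r * y r) := by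
          rw [map_sum]
          exact sum_congr rfl fun r _ => (H.π_mul _ _ (ha r)).symm
        rw [hε, hxε, Ideal.Quotient.eq] at hy
        rw [hε, hxε, Ideal.Quotient.eq, h1]
        have h2 := H.π_of_mem hx
        rw [← h2, ← map_sub]
        exact hI _ hy _
    exact ⟨⟨φ, hφ, fun x => (F'.exact_zero _).1
      (by rw [hφε, F.exact_zero.apply_apply_eq_zero])⟩, hφε⟩
  have step : ∀ i (φ : S i), ∃ ψ : S (i + 1), ∀ x, F'.d i (ψ.1 x) = φ.1 (F.d i x) := by
    rintro i ⟨φ, hφ, hφd⟩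
    obtain ⟨ψ, hψ, hψd⟩ := (hF'.hom i).exists_lift (hφ.comp (hF.hom i)) hφd
    exact ⟨⟨ψ, hψ, fun x => (F'.exact_succ i _).1
      (by simp [hψd, (F.exact_succ i).apply_apply_eq_zero])⟩, hψd⟩
  obtain ⟨φ₀, hφ₀⟩ := base
  choose next hnext using step
  let φ : ∀ i, S i := fun i => Nat.rec φ₀ (fun i φ => next i φ) i
  exact ⟨fun i => (φ i).1, fun i => (φ i).2.1, hφ₀, fun i => hnext i (φ i)⟩

theorem IsMinimalHom.card_le {F F' : FreeResolution R (R ⧸ I)}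
    {deg : ∀ i, Fin (F.rank i) → ℕ} {deg' : ∀ i, Fin (F'.rank i) → ℕ} (h𝔪 : 𝔪 ≠ ⊤)
    (hI : ∀ x ∈ I, ∀ m, H.π 0 m x ∈ I)
    (hF : F.IsMinimalHom H deg) (hF' : F'.IsMinimalHom H deg') (i : ℕ) (P : ℕ → Prop)
    [DecidablePred P] :
    Fintype.card {r // P (deg i r)} ≤ Fintype.card {r // P (deg' i r)} := by
  obtain ⟨φ, hφ, hφε, hφd⟩ := hF.exists_map hI hF'
  obtain ⟨ψ, -, hψε, hψd⟩ := hF'.exists_map hI hF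
  refine card_le_of_comp_eq_one_mod h𝔪 (hφ i) (ψ := ψ i) (fun x r => ?_) P
  exact mem_of_comp_eq_zero (χ := fun i => ψ i ∘ₗ φ i - LinearMap.id) hF.mem
    (by simp [hφε, hψε]) (by simp [hφd, hψd]) i x r

/-- The numbers of basis vectors with given degrees in a minimal resolution are unique. -/
theorem IsMinimalHom.card_eq {F F' : FreeResolution R (R ⧸ I)}
    {deg : ∀ i, Fin (F.rank i) → ℕ} {deg' : ∀ i, Fin (F'.rank i) → ℕ} (h𝔪 : 𝔪 ≠ ⊤)
    (hI : ∀ x ∈ I, ∀ m, H.π 0 m x ∈ I)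
    (hF : F.IsMinimalHom H deg) (hF' : F'.IsMinimalHom H deg') (i : ℕ) (P : ℕ → Prop)
    [DecidablePred P] :
    Fintype.card {r // P (deg i r)} = Fintype.card {r // P (deg' i r)} :=
  (hF.card_le h𝔪 hI hF' i P).antisymm (hF'.card_le h𝔪 hI hF i P)

end FreeResolution

/-! ### The double complex of the truncated resolutions and its exactness -/

namespace CyclicResolution

variable {R : Type u} [CommRing R] {I J 𝔪 : Ideal R}

theorem D_mul_D (F : CyclicResolution J) (i : ℕ) : F.D i * F.D (i + 1) = 0 := by
  ext r c
  have := (F.exact_succ i _).2 ⟨Pi.single c 1, rfl⟩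
  rw [mulVec_mulVec] at this
  simpa using congrFun this r

theorem D_zero_mulVec_mem (F : CyclicResolution J) (y : F.ι 1 → R) (r : F.ι 0) :
    (F.D 0 *ᵥ y) r ∈ J := by
  rw [Subsingleton.elim r default]
  exact (F.exact_zero _).2 ⟨y, rfl⟩

theorem D_zero_mem (F : CyclicResolution J) (r : F.ι 0) (c : F.ι 1) : F.D 0 r c ∈ J :=
  mem_of_forall_mulVec_mem F.D_zero_mulVec_mem r c

theorem mul_transpose_row {α β γ : Type*} [Fintype β] (M : Matrix α β R) (N : Matrix γ β R)
    (r : α) : (M * Nᵀ) r = N *ᵥ M r := by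
  ext s
  simp [mul_apply, mulVec, dotProduct, mul_comm]

/-- Elements of a tensor product of free modules are written as matrices: `F` acts by left
multiplication, `G` by right multiplication with transposes. The latter applies the differential of
`G` to every row, so exactness is inherited row by row. -/
theorem exists_eq_mul_transpose (G : CyclicResolution I) {α : Type*} (i : ℕ)
    (x : Matrix α (G.ι (i + 1)) R) (hx : x * (G.D i)ᵀ = 0) :
    ∃ w : Matrix α (G.ι (i + 1 + 1)) R, x = w * (G.D (i + 1))ᵀ := by
  choose w hw using fun r => (G.exact_succ i (x r)).1 (by rw [← mul_transpose_row, hx]; rfl)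
  exact ⟨of w, funext fun r => (hw r).symm.trans (mul_transpose_row (of w) _ r).symm⟩

/-- `F ⊗ R ⧸ I` is exact in homological degrees at least two. -/
def IsExactMod (F : CyclicResolution J) (I : Ideal R) : Prop :=
  ∀ n (y : F.ι (n + 2) → R), (∀ r, (F.D (n + 1) *ᵥ y) r ∈ I) →
    ∃ z, ∀ r, (y - F.D (n + 2) *ᵥ z) r ∈ I

/-- This handles the edge where `G 0` has been cut off. Applying `G.D 0` to `x` gives a cycle of `F`
with entries in `I`, hence a boundary of some `y`, which is a cycle modulo `I`. Up to a boundary,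
`y` has entries in `I` and lifts to `v` through `G 1`; what remains of `x` is killed by `G.D 0` and
comes from `G 2`. -/
theorem IsExactMod.exists_eq_add {F : CyclicResolution J} (hF : F.IsExactMod I)
    (G : CyclicResolution I) (n : ℕ) (x : Matrix (F.ι (n + 1)) (G.ι 1) R)
    (hx : F.D n * x * (G.D 0)ᵀ = 0) :
    ∃ (v : Matrix (F.ι (n + 2)) (G.ι 1) R) (w : Matrix (F.ι (n + 1)) (G.ι 2) R),
      x = F.D (n + 1) * v + w * (G.D 1)ᵀ := by
  have hrow : ∀ r, (x * (G.D 0)ᵀ) r default ∈ I := fun r => by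
    rw [mul_transpose_row]
    exact G.D_zero_mulVec_mem _ _
  obtain ⟨y, hy⟩ := (F.exact_succ n fun r => (x * (G.D 0)ᵀ) r default).1 <| by
    ext r
    rw [Matrix.mul_assoc] at hx
    exact congrFun (congrFun hx r) default
  obtain ⟨z, hz⟩ := hF n y fun r => by
    rw [hy]
    exact hrow r
  choose v hv using fun c => (G.exact_zero fun _ => (y - F.D (n + 2) *ᵥ z) c).1 (hz c)
  have h1 : (x - F.D (n + 1) * of v) * (G.D 0)ᵀ = 0 := by
    rw [Matrix.sub_mul, sub_eq_zero, Matrix.mul_assoc]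
    ext r s
    have h2 : F.D (n + 1) *ᵥ (y - F.D (n + 2) *ᵥ z) = fun r => (x * (G.D 0)ᵀ) r default := by
      rw [mulVec_sub, hy, mulVec_mulVec, D_mul_D, zero_mulVec, sub_zero]
    have h3 : ∀ c, (of v * (G.D 0)ᵀ) c s = (y - F.D (n + 2) *ᵥ z) c := fun c => by
      rw [mul_transpose_row]
      exact congrFun (hv c) s
    rw [Subsingleton.elim s default] at h3 ⊢
    rw [← congrFun h2 r]
    simp only [mul_apply (M := F.D (n + 1)), h3]
    rfl
  obtain ⟨w, hw⟩ := G.exists_eq_mul_transpose 0 _ h1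
  exact ⟨of v, w, by rw [← hw, add_sub_cancel]⟩

variable (F : CyclicResolution J) (G : CyclicResolution I)

/-- The elements of the product of all `F (i + 1) ⊗ G (j + 1)`. -/
abbrev Family : Type u := ∀ i j : ℕ, Matrix (F.ι (i + 1)) (G.ι (j + 1)) R

/-- The differential of the total complex of `F (i + 1) ⊗ G (j + 1)`. -/
def familyD : Family F G →ₗ[R] Family F G where
  toFun z i j := F.D (i + 1) * z (i + 1) j + (-1 : R) ^ i • (z i (j + 1) * (G.D (j + 1))ᵀ)
  map_add' x y := by
    funext i j
    simp only [Pi.add_apply, Matrix.mul_add, Matrix.add_mul, smul_add]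
    abel
  map_smul' a x := by
    funext i j
    simp only [Pi.smul_apply, Matrix.mul_smul, Matrix.smul_mul, smul_add, RingHom.id_apply,
      smul_comm a]

theorem familyD_apply (z : Family F G) (i j : ℕ) : familyD F G z i j =
    F.D (i + 1) * z (i + 1) j + (-1 : R) ^ i • (z i (j + 1) * (G.D (j + 1))ᵀ) := rfl

theorem familyD_familyD (z : Family F G) : familyD F G (familyD F G z) = 0 := by
  funext i j
  have h1 : (G.D (j + 1 + 1))ᵀ * (G.D (j + 1))ᵀ = 0 := by
    rw [← transpose_mul, D_mul_D, transpose_zero]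
  simp only [familyD_apply, Matrix.mul_add, Matrix.add_mul, Matrix.smul_mul, Matrix.mul_smul,
    Matrix.mul_assoc, h1, ← Matrix.mul_assoc (F.D (i + 1)) (F.D (i + 1 + 1)), D_mul_D]
  simp [pow_succ]

theorem D_zero_mul_familyD_mul (z : Family F G) :
    F.D 0 * familyD F G z 0 0 * (G.D 0)ᵀ = 0 := by
  have h1 : (G.D 1)ᵀ * (G.D 0)ᵀ = 0 := by
    rw [← transpose_mul, D_mul_D, transpose_zero]
  simp only [familyD_apply, Matrix.mul_add, Matrix.add_mul, Matrix.smul_mul, Matrix.mul_smul,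
    Matrix.mul_assoc, h1, ← Matrix.mul_assoc (F.D 0) (F.D (0 + 1)), D_mul_D]
  simp

variable {F G}

/-- Exactness of the total complex. -/
theorem IsExactMod.exists_familyD_eq (hF : F.IsExactMod I) (n : ℕ) (z : Family F G)
    (hz : ∀ i j, i + j + 1 = n → familyD F G z i j = 0)
    (hz₀ : n = 0 → F.D 0 * z 0 0 * (G.D 0)ᵀ = 0) :
    ∃ y, ∀ i j, i + j = n → familyD F G y i j = z i j := by
  -- The equation is solved column by column; `k` bounds the columns in which it already holds.
  suffices h : ∀ k, ∃ y, ∀ i j, i + j = n → j ≤ k → familyD F G y i j = z i j by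
    obtain ⟨y, hy⟩ := h n
    exact ⟨y, fun i j hij => hy i j hij (by lia)⟩
  intro k
  induction k with
  | zero =>
    have h0 : F.D n * z n 0 * (G.D 0)ᵀ = 0 := by
      obtain _ | n := n
      · exact hz₀ rfl
      · have h1 := hz n 0 rfl
        rw [familyD_apply, add_eq_zero_iff_eq_neg] at h1
        have h2 : (G.D 1)ᵀ * (G.D 0)ᵀ = 0 := by
          rw [← transpose_mul, D_mul_D, transpose_zero]
        rw [h1, Matrix.neg_mul, Matrix.smul_mul, Matrix.mul_assoc, h2]
        simp
    obtain ⟨v, w, hvw⟩ := hF.exists_eq_add G n _ h0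
    -- The factor `(-1) ^ n` cancels the sign in `familyD`.
    refine ⟨Function.update (Function.update 0 (n + 1) (Function.update 0 0 v)) n
      (Function.update 0 1 ((-1 : R) ^ n • w)), fun i j hij hj => ?_⟩
    obtain rfl : j = 0 := by lia
    obtain rfl : i = n := by lia
    rw [familyD_apply, hvw]
    simp [smul_smul, ← mul_pow]
  | succ k ih =>
    obtain ⟨y, hy⟩ := ih
    by_cases hk : k + 1 ≤ n
    swap
    · exact ⟨y, fun i j hij hj => hy i j hij (by lia)⟩
    obtain ⟨p, rfl⟩ : ∃ p, n = p + (k + 1) := ⟨n - (k + 1), by lia⟩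
    -- The error is a cycle at this position and vanishes at `(p + 1, k)`, so its entry at `(p, k +
    -- 1)` is killed by the differential of `G` alone.
    have h1 : familyD F G (z - familyD F G y) p k = 0 := by
      rw [map_sub, familyD_familyD, sub_zero, hz p k (by lia)]
    rw [familyD_apply, Pi.sub_apply, Pi.sub_apply, hy (p + 1) k (by lia) le_rfl, sub_self,
      Matrix.mul_zero, zero_add] at h1
    have h2 : (z - familyD F G y) p (k + 1) * (G.D (k + 1))ᵀ = 0 := by
      have := congrArg ((-1 : R) ^ p • ·) h1
      simpa only [smul_smul, ← mul_pow, neg_mul_neg, one_mul, one_pow, one_smul, smul_zero]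
        using this
    obtain ⟨w, hw⟩ := G.exists_eq_mul_transpose (k + 1) _ h2
    -- A correction in column `k + 2` has its differential in columns `k + 1` and `k + 2` only, so
    -- the columns already solved stay intact.
    obtain ⟨u, hu, hu₀⟩ : ∃ u : Family F G, u p (k + 2) = (-1 : R) ^ p • w ∧
        ∀ i j, j ≠ k + 2 → u i j = 0 := by
      refine ⟨Function.update (0 : Family F G) p (Function.update 0 (k + 2) ((-1 : R) ^ p • w)),
        by simp, fun i j hj => ?_⟩
      rcases eq_or_ne i p with rfl | hi
      · rw [Function.update_self, Function.update_of_ne hj]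
        rfl
      · rw [Function.update_of_ne hi]
        rfl
    refine ⟨y + u, fun i j hij hj => ?_⟩
    rw [map_add, Pi.add_apply, Pi.add_apply, familyD_apply F G u]
    rcases hj.lt_or_eq with hj | rfl
    · rw [hy i j hij (by lia), hu₀ (i + 1) j (by lia), hu₀ i (j + 1) (by lia)]
      simp
    · obtain rfl : i = p := by lia
      rw [hu₀ (i + 1) (k + 1) (by lia), hu,
        sub_eq_iff_eq_add'.1 hw]
      simp [smul_smul, ← mul_pow]

/-! ### The resolution of `R ⧸ J * I` in each degree -/

variable (F G)

/-- The basis of the `n`-th module of the resolution of `R ⧸ J * I` built from `F` and `G`. -/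
def totalIndex : ℕ → Type
  | 0 => Unit
  | n + 1 => Σ p : antidiagonal n, F.ι (p.1.1 + 1) × G.ι (p.1.2 + 1)

instance : ∀ n, Fintype (totalIndex F G n)
  | 0 => inferInstanceAs (Fintype Unit)
  | n + 1 => inferInstanceAs (Fintype (Σ p : antidiagonal n, F.ι (p.1.1 + 1) × G.ι (p.1.2 + 1)))

instance : ∀ n, DecidableEq (totalIndex F G n)
  | 0 => inferInstanceAs (DecidableEq Unit)
  | n + 1 =>
    inferInstanceAs (DecidableEq (Σ p : antidiagonal n, F.ι (p.1.1 + 1) × G.ι (p.1.2 + 1)))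

instance : Unique (totalIndex F G 0) := inferInstanceAs (Unique Unit)

/-- Extension of an element of total degree `n` by zero. -/
def toFamily (n : ℕ) : (totalIndex F G (n + 1) → R) →ₗ[R] Family F G where
  toFun x i j := of fun r s =>
    if h : (i, j) ∈ antidiagonal n then x ⟨⟨(i, j), h⟩, r, s⟩ else 0
  map_add' x y := by
    funext i j r s
    change (if h : (i, j) ∈ antidiagonal n then (x + y) ⟨⟨(i, j), h⟩, r, s⟩ else 0) =
      (if h : (i, j) ∈ antidiagonal n then x ⟨⟨(i, j), h⟩, r, s⟩ else 0) +
        if h : (i, j) ∈ antidiagonal n then y ⟨⟨(i, j), h⟩, r, s⟩ else 0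
    by_cases h : (i, j) ∈ antidiagonal n
    · rw [dif_pos h, dif_pos h, dif_pos h]
      rfl
    · rw [dif_neg h, dif_neg h, dif_neg h, add_zero]
  map_smul' a x := by
    funext i j r s
    change (if h : (i, j) ∈ antidiagonal n then (a • x) ⟨⟨(i, j), h⟩, r, s⟩ else 0) =
      a * if h : (i, j) ∈ antidiagonal n then x ⟨⟨(i, j), h⟩, r, s⟩ else 0
    by_cases h : (i, j) ∈ antidiagonal n
    · rw [dif_pos h, dif_pos h]
      rfl
    · rw [dif_neg h, dif_neg h, mul_zero]

/-- The component of total degree `n`. -/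
def ofFamily (n : ℕ) : Family F G →ₗ[R] (totalIndex F G (n + 1) → R) where
  toFun z a := z a.1.1.1 a.1.1.2 a.2.1 a.2.2
  map_add' _ _ := rfl
  map_smul' _ _ := rfl

variable {F G}

theorem ofFamily_apply {n : ℕ} (z : Family F G) (p : antidiagonal n) (r s) :
    ofFamily F G n z ⟨p, r, s⟩ = z p.1.1 p.1.2 r s := rfl

/-- Families range over all pairs of indices, so the identities for the differential need no
transport along equations between total degrees. The finite free modules are then the pieces of
fixed total degree. -/
theorem toFamily_ofFamily (n : ℕ) (z : Family F G) {i j : ℕ} (h : i + j = n) :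
    toFamily F G n (ofFamily F G n z) i j = z i j := by
  ext r s
  exact dif_pos (mem_antidiagonal.2 h)

theorem ofFamily_toFamily (n : ℕ) (x : totalIndex F G (n + 1) → R) :
    ofFamily F G n (toFamily F G n x) = x := by
  funext ⟨⟨⟨i, j⟩, h⟩, r, s⟩
  exact dif_pos h

variable (F G)

/-- The differentials of the resolution of `R ⧸ J * I` built from `F` and `G`. -/
def totalD : ∀ n, (totalIndex F G (n + 1) → R) →ₗ[R] (totalIndex F G n → R)
  | 0 =>
    { toFun := fun x _ => (F.D 0 * toFamily F G 0 x 0 0 * (G.D 0)ᵀ) default default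
      map_add' := fun x y => by
        funext
        simp [Matrix.mul_add, Matrix.add_mul]
      map_smul' := fun a x => by
        funext
        simp }
  | n + 1 => ofFamily F G n ∘ₗ familyD F G ∘ₗ toFamily F G (n + 1)

variable {F G}

theorem totalD_zero_apply (x : totalIndex F G 1 → R) (a) :
    totalD F G 0 x a = (F.D 0 * toFamily F G 0 x 0 0 * (G.D 0)ᵀ) default default := rfl

theorem totalD_succ_apply (n : ℕ) (x : totalIndex F G (n + 2) → R) :
    totalD F G (n + 1) x = ofFamily F G n (familyD F G (toFamily F G (n + 1) x)) := rfl

theorem totalD_zero_apply_eq (x : totalIndex F G 1 → R) (a) :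
    totalD F G 0 x a = ∑ r, F.D 0 default r * (G.D 0 *ᵥ toFamily F G 0 x 0 0 r) default := by
  rw [totalD_zero_apply, Matrix.mul_assoc, mul_apply]
  simp only [mul_transpose_row]

theorem mem_mul_iff_exists_totalD_eq (x : totalIndex F G 0 → R) :
    x default ∈ J * I ↔ ∃ y, totalD F G 0 y = x := by
  constructor
  · intro hx
    have h : J * I ≤ LinearMap.range (LinearMap.proj (R := R) (φ := fun _ : totalIndex F G 0 => R)
        default ∘ₗ totalD F G 0) := by
      refine Ideal.mul_le.2 fun a ha b hb => ?_
      obtain ⟨y, hy⟩ := (F.exact_zero fun _ => a).1 ha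
      obtain ⟨w, hw⟩ := (G.exact_zero fun _ => b).1 hb
      -- The rank-one matrix is the pure tensor `y ⊗ w` of preimages of `a` and `b`; it maps to `a *
      -- b`.
      let z : Family F G := Function.update 0 0 (Function.update 0 0 (vecMulVec y w))
      have hz : z 0 0 = vecMulVec y w := by simp [z]
      refine ⟨ofFamily F G 0 z, ?_⟩
      rw [LinearMap.comp_apply, LinearMap.proj_apply, totalD_zero_apply_eq,
        toFamily_ofFamily 0 z rfl, hz, ← congrFun hy default, ← congrFun hw default]
      have h1 : ∀ r, vecMulVec y w r = y r • w := fun r => rfl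
      simp only [h1, mulVec, dotProduct, Pi.smul_apply, smul_eq_mul, sum_mul, mul_assoc]
      refine sum_congr rfl fun c _ => congrArg _ ?_
      rw [mul_sum]
      exact sum_congr rfl fun _ _ => mul_left_comm _ _ _
    obtain ⟨y, hy⟩ := h hx
    refine ⟨y, funext fun a => ?_⟩
    rw [Subsingleton.elim a default]
    exact hy
  · rintro ⟨y, rfl⟩
    rw [totalD_zero_apply_eq]
    exact Ideal.sum_mem _ fun r _ =>
      Ideal.mul_mem_mul (F.D_zero_mem _ _) (G.D_zero_mulVec_mem _ _)

theorem toFamily_totalD (n : ℕ) (x : totalIndex F G (n + 2) → R) {i j : ℕ} (h : i + j = n) :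
    toFamily F G n (totalD F G (n + 1) x) i j = familyD F G (toFamily F G (n + 1) x) i j := by
  rw [totalD_succ_apply, toFamily_ofFamily n _ h]

theorem totalD_comp (n : ℕ) (x : totalIndex F G (n + 2) → R) :
    totalD F G n (totalD F G (n + 1) x) = 0 := by
  obtain _ | n := n
  · funext a
    rw [totalD_zero_apply, toFamily_totalD 0 x rfl, D_zero_mul_familyD_mul]
    rfl
  · funext ⟨p, r, s⟩
    have hp := mem_antidiagonal.1 p.2
    rw [totalD_succ_apply, ofFamily_apply, familyD_apply, toFamily_totalD _ _ (by lia),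
      toFamily_totalD _ _ (by lia), ← familyD_apply, familyD_familyD]
    rfl

theorem IsExactMod.exists_totalD_eq (hF : F.IsExactMod I) (n : ℕ)
    (x : totalIndex F G (n + 1) → R) (hx : totalD F G n x = 0) :
    ∃ y, totalD F G (n + 1) y = x := by
  have h₁ : ∀ i j, i + j + 1 = n → familyD F G (toFamily F G n x) i j = 0 := by
    rintro i j rfl
    ext r s
    exact congrFun hx ⟨⟨(i, j), mem_antidiagonal.2 rfl⟩, r, s⟩
  have h₂ : n = 0 → F.D 0 * toFamily F G n x 0 0 * (G.D 0)ᵀ = 0 := by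
    rintro rfl
    ext r s
    rw [Subsingleton.elim r default, Subsingleton.elim s default]
    exact congrFun hx default
  obtain ⟨y, hy⟩ := hF.exists_familyD_eq n (toFamily F G n x) h₁ h₂
  refine ⟨ofFamily F G (n + 1) y, ?_⟩
  rw [← ofFamily_toFamily n x]
  funext ⟨p, r, s⟩
  have hp := mem_antidiagonal.1 p.2
  rw [totalD_succ_apply, ofFamily_apply, ofFamily_apply, ← hy _ _ hp, familyD_apply,
    toFamily_ofFamily _ _ (by lia), toFamily_ofFamily _ _ (by lia), ← familyD_apply]

/-- The resolution of `R ⧸ J * I` built from resolutions of `R ⧸ J` and `R ⧸ I`. -/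
def total (F : CyclicResolution J) (G : CyclicResolution I) (hF : F.IsExactMod I) :
    CyclicResolution (J * I) where
  ι := totalIndex F G
  D n := LinearMap.toMatrix' (totalD F G n)
  exact_zero x := by
    simp only [LinearMap.toMatrix'_mulVec]
    exact mem_mul_iff_exists_totalD_eq x
  exact_succ n x := by
    simp only [LinearMap.toMatrix'_mulVec]
    refine ⟨hF.exists_totalD_eq n x, ?_⟩
    rintro ⟨y, rfl⟩
    exact totalD_comp n y

/-! ### Degrees and minimality of the total resolution -/

variable {H : EntryGrading R 𝔪}

/-- The degrees of the basis vectors of the total resolution. -/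
def totalDeg (degF : ∀ i, F.ι i → ℕ) (degG : ∀ i, G.ι i → ℕ) : ∀ n, totalIndex F G n → ℕ
  | 0 => fun _ => 0
  | _ + 1 => fun a => degF _ a.2.1 + degG _ a.2.2

theorem toFamily_mem_hom {degF : ∀ i, F.ι i → ℕ} {degG : ∀ i, G.ι i → ℕ} {n m : ℕ}
    {x : totalIndex F G (n + 1) → R} (hx : H.IsHomVec (totalDeg degF degG (n + 1)) m x)
    (i j : ℕ) (r s) : toFamily F G n x i j r s ∈ H.hom (degF _ r + degG _ s) m := by
  by_cases h : (i, j) ∈ antidiagonal n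
  · have h1 : toFamily F G n x i j r s = x ⟨⟨(i, j), h⟩, r, s⟩ := dif_pos h
    rw [h1]
    exact hx ⟨⟨(i, j), h⟩, r, s⟩
  · have h1 : toFamily F G n x i j r s = 0 := dif_neg h
    rw [h1]
    exact zero_mem _

theorem D_mul_mem_hom {degF : ∀ i, F.ι i → ℕ} {i : ℕ}
    (hF : H.IsHomMat (degF i) (degF (i + 1)) (F.D i)) {β : Type*} {Z : Matrix (F.ι (i + 1)) β R}
    {m : ℕ} {s : β} {e : ℕ} (hZ : ∀ r, Z r s ∈ H.hom (degF _ r + e) m) (r) :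
    (F.D i * Z) r s ∈ H.hom (degF i r + e) m := by
  rw [mul_apply]
  exact sum_mem fun c _ => H.mul_mem (H.add_right_mem e (hF r c)) (hZ c)

theorem mul_D_transpose_mem_hom {degG : ∀ i, G.ι i → ℕ} {i : ℕ}
    (hG : H.IsHomMat (degG i) (degG (i + 1)) (G.D i)) {β : Type*} {Z : Matrix β (G.ι (i + 1)) R}
    {m : ℕ} {r : β} {e : ℕ} (hZ : ∀ s, Z r s ∈ H.hom (e + degG _ s) m) (s) :
    (Z * (G.D i)ᵀ) r s ∈ H.hom (e + degG i s) m := by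
  rw [mul_transpose_row]
  refine sum_mem fun c _ => H.mul_mem ?_ (hZ c)
  rw [add_comm e, add_comm e]
  exact H.add_right_mem e (hG s c)

/-- Minimality holds because each coordinate of a differential is a combination of entries of `F.D`
and `G.D`, all in `𝔪`; homogeneity, because degrees add in a tensor product. -/
theorem IsMinimalHom.total {degF : ∀ i, F.ι i → ℕ} {degG : ∀ i, G.ι i → ℕ}
    (hF : F.IsMinimalHom H degF) (hG : G.IsMinimalHom H degG) (hFI : F.IsExactMod I) :
    (total F G hFI).IsMinimalHom H (totalDeg degF degG) where
  deg_zero := rfl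
  hom n := EntryGrading.isHomLin_of_forall (f := totalD F G n) fun c => by
    have key := toFamily_mem_hom (H := H) (degF := degF) (degG := degG)
      (EntryGrading.isHomVec_single c)
    obtain _ | n := n
    · intro a
      -- Both resolutions start in degree 0, so the last module may be read as `F 0 ⊗ G 0` and the
      -- differentials of the two factors are treated separately.
      have h1 : (totalDeg degF degG 0 a) = degF 0 default + degG 0 default := by
        rw [hF.deg_zero, hG.deg_zero]
        rfl
      rw [h1, totalD_zero_apply]
      exact mul_D_transpose_mem_hom (hG.hom 0)
        (fun s => D_mul_mem_hom (hF.hom 0) (fun r => key 0 0 r s) _) _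
    · rintro ⟨p, r, s⟩
      rw [totalD_succ_apply, ofFamily_apply, familyD_apply, Matrix.add_apply, Matrix.smul_apply,
        smul_eq_mul]
      refine add_mem (D_mul_mem_hom (hF.hom _) (fun r => key _ _ r s) r) ?_
      have h2 := mul_D_transpose_mem_hom (hG.hom _) (fun s => key p.1.1 (p.1.2 + 1) r s) s
      rcases neg_one_pow_eq_or R p.1.1 with h | h
      · rw [h, one_mul]
        exact h2
      · rw [h, neg_one_mul]
        exact neg_mem h2
  mem n := mem_of_forall_mulVec_mem (D := LinearMap.toMatrix' (totalD F G n)) fun y r => by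
    rw [LinearMap.toMatrix'_mulVec]
    obtain _ | n := n
    · rw [totalD_zero_apply_eq]
      exact Ideal.sum_mem _ fun c _ => Ideal.mul_mem_right _ _ (hF.mem _ _ _)
    · obtain ⟨p, r, s⟩ := r
      rw [totalD_succ_apply, ofFamily_apply, familyD_apply, Matrix.add_apply, Matrix.smul_apply,
        mul_apply, mul_transpose_row, mulVec]
      exact Ideal.add_mem _
        (Ideal.sum_mem _ fun c _ => Ideal.mul_mem_right _ _ (hF.mem _ _ _))
        (Ideal.mul_mem_left _ _
          (Ideal.sum_mem _ fun c _ => Ideal.mul_mem_right _ _ (hG.mem _ _ _)))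

end CyclicResolution

/-! ### Tor-independence as exactness modulo `I` -/

namespace CyclicResolution

variable {R : Type u} [CommRing R] {I J : Ideal R}

/-- The chain complex of a resolution of `R ⧸ J`. -/
noncomputable def complex (F : CyclicResolution J) : ChainComplex (ModuleCat.{u} R) ℕ :=
  ChainComplex.of (fun i => ModuleCat.of R (F.ι i → R))
    (fun i => ModuleCat.ofHom (F.D i).mulVecLin) fun i => by
      rw [← ModuleCat.ofHom_comp, ← mulVecLin_mul, D_mul_D]
      ext x
      simp

theorem complex_d (F : CyclicResolution J) (i : ℕ) :
    F.complex.d (i + 1) i = ModuleCat.ofHom (F.D i).mulVecLin :=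
  ChainComplex.of_d (fun i => ModuleCat.of R (F.ι i → R))
    (fun i => ModuleCat.ofHom (F.D i).mulVecLin) i

/-- The augmentation of a resolution of `R ⧸ J`. -/
def aug (F : CyclicResolution J) : (F.ι 0 → R) →ₗ[R] (R ⧸ J) :=
  J.mkQ ∘ₗ LinearMap.proj default

theorem aug_surjective (F : CyclicResolution J) : Function.Surjective F.aug := by
  intro x
  obtain ⟨a, rfl⟩ := Ideal.Quotient.mk_surjective x
  exact ⟨fun _ => a, rfl⟩

theorem exact_aug (F : CyclicResolution J) : Function.Exact (F.D 0).mulVecLin F.aug := by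
  intro x
  refine Iff.trans ?_ (F.exact_zero x)
  exact Ideal.Quotient.eq_zero_iff_mem

theorem exact_mulVecLin (F : CyclicResolution J) (i : ℕ) :
    Function.Exact (F.D (i + 1)).mulVecLin (F.D i).mulVecLin := fun x => F.exact_succ i x

theorem complex_exactAt_succ (F : CyclicResolution J) (n : ℕ) : F.complex.ExactAt (n + 1) := by
  rw [HomologicalComplex.exactAt_iff' _ (n + 1 + 1) (n + 1) n (by simp) (by simp)]
  rw [ShortComplex.ShortExact.moduleCat_exact_iff_function_exact]
  change Function.Exact (F.complex.d (n + 1 + 1) (n + 1)).hom (F.complex.d (n + 1) n).hom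
  rw [complex_d, complex_d]
  exact F.exact_mulVecLin n

/-- The projective resolution of `R ⧸ J` in the category of modules. -/
noncomputable def projectiveResolution (F : CyclicResolution J) :
    ProjectiveResolution (ModuleCat.of R (R ⧸ J)) where
  complex := F.complex
  projective n := inferInstanceAs (Projective (ModuleCat.of R (F.ι n → R)))
  π := (ChainComplex.toSingle₀Equiv _ _).symm ⟨ModuleCat.ofHom F.aug, by
    rw [complex_d]
    ext x
    exact F.exact_aug.apply_apply_eq_zero x⟩
  quasiIso := ⟨fun n => by
    cases n
    · rw [ChainComplex.quasiIsoAt₀_iff, ShortComplex.quasiIso_iff_of_zeros']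
      · refine ⟨?_, ?_⟩
        · rw [ShortComplex.ShortExact.moduleCat_exact_iff_function_exact]
          change Function.Exact (F.complex.d 1 0).hom F.aug
          rw [complex_d]
          exact F.exact_aug
        · rw [ModuleCat.epi_iff_surjective]
          exact F.aug_surjective
      all_goals rfl
    · rw [quasiIsoAt_iff_exactAt']
      · apply complex_exactAt_succ
      · apply ChainComplex.exactAt_succ_single_obj⟩

/-- `Tor` is derived in its second argument, so it is the homology of `R ⧸ I` tensored with the
resolution `F` of `R ⧸ J`. -/
theorem exact_lTensor (F : CyclicResolution J) (h : I.TorIndependent J) (n : ℕ) :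
    Function.Exact ((F.D (n + 1)).mulVecLin.lTensor (R ⧸ I)) ((F.D n).mulVecLin.lTensor (R ⧸ I)) := by
  have h1 := (h (n + 1) (by lia)).of_iso (F.projectiveResolution.isoLeftDerivedObj
    ((MonoidalCategory.tensoringLeft (ModuleCat.{u} R)).obj (ModuleCat.of R (R ⧸ I))) (n + 1)).symm
  have h2 := (HomologicalComplex.exactAt_iff_isZero_homology _ _).2 h1
  rw [HomologicalComplex.exactAt_iff' _ (n + 1 + 1) (n + 1) n (by simp) (by simp),
    ShortComplex.ShortExact.moduleCat_exact_iff_function_exact] at h2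
  have h3 : ∀ i, (((MonoidalCategory.tensoringLeft (ModuleCat.{u} R)).obj
      (ModuleCat.of R (R ⧸ I))).map (F.complex.d (i + 1) i)).hom =
      (F.D i).mulVecLin.lTensor (R ⧸ I) := fun i => by
    rw [complex_d]
    rfl
  rw [← h3, ← h3]
  exact h2

theorem tmul_eq_zero_iff {ι : Type*} [Fintype ι] [DecidableEq ι] (x : ι → R) :
    (1 : R ⧸ I) ⊗ₜ[R] x = 0 ↔ ∀ r, x r ∈ I := by
  constructor
  · intro h r
    have h1 := congrArg (TensorProduct.rid R (R ⧸ I) ∘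
      (LinearMap.proj (R := R) (φ := fun _ : ι => R) r).lTensor (R ⧸ I)) h
    simp only [Function.comp_apply, LinearMap.lTensor_tmul, LinearMap.proj_apply,
      TensorProduct.rid_tmul, map_zero] at h1
    rw [← Ideal.Quotient.eq_zero_iff_mem, ← h1, Algebra.smul_def, mul_one]
    rfl
  · intro h
    rw [pi_eq_sum_univ' x, tmul_sum]
    refine sum_eq_zero fun r _ => ?_
    rw [tmul_smul, smul_tmul', Algebra.smul_def, mul_one]
    have : algebraMap R (R ⧸ I) (x r) = 0 := Ideal.Quotient.eq_zero_iff_mem.2 (h r)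
    rw [this, zero_tmul]

theorem exists_eq_one_tmul {M : Type*} [AddCommGroup M] [Module R M] (w : (R ⧸ I) ⊗[R] M) :
    ∃ z : M, w = 1 ⊗ₜ z := by
  induction w with
  | zero => exact ⟨0, (tmul_zero _ _).symm⟩
  | tmul a z =>
    obtain ⟨a, rfl⟩ := Ideal.Quotient.mk_surjective a
    refine ⟨a • z, ?_⟩
    rw [tmul_smul, smul_tmul', Algebra.smul_def, mul_one]
    rfl
  | add x y hx hy =>
    obtain ⟨x, rfl⟩ := hx
    obtain ⟨y, rfl⟩ := hy
    exact ⟨x + y, (tmul_add _ _ _).symm⟩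

/-- Every element of `R ⧸ I ⊗ F n` has the form `1 ⊗ z`, and it vanishes exactly when the
coordinates of `z` lie in `I`; this translates exactness of the tensored complex into congruences.
-/
theorem isExactMod (F : CyclicResolution J) (h : I.TorIndependent J) : F.IsExactMod I := by
  intro n y hy
  have h1 : (F.D (n + 1)).mulVecLin.lTensor (R ⧸ I) ((1 : R ⧸ I) ⊗ₜ y) = 0 := by
    rw [LinearMap.lTensor_tmul, tmul_eq_zero_iff]
    exact hy
  obtain ⟨w, hw⟩ := (F.exact_lTensor h (n + 1) _).1 h1
  obtain ⟨z, rfl⟩ := exists_eq_one_tmul w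
  refine ⟨z, (tmul_eq_zero_iff _).1 ?_⟩
  rw [tmul_sub, sub_eq_zero, ← hw, LinearMap.lTensor_tmul]
  rfl

end CyclicResolution

/-! ### Counting basis vectors -/

namespace CyclicResolution

variable {R : Type u} [CommRing R] {I J 𝔪 : Ideal R} {H : EntryGrading R 𝔪}

/-- The resolution with its bases enumerated. -/
noncomputable def toFreeResolution (F : CyclicResolution I) : FreeResolution R (R ⧸ I) where
  rank i := Fintype.card (F.ι i)
  d i := ((F.D i).submatrix (Fintype.equivFin _).symm (Fintype.equivFin _).symm).mulVecLin
  ε := I.mkQ ∘ₗ LinearMap.proj (Fintype.equivFin (F.ι 0) default)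
  surjective x := by
    obtain ⟨a, rfl⟩ := Ideal.Quotient.mk_surjective x
    exact ⟨fun _ => a, rfl⟩
  exact_zero x := by
    refine Ideal.Quotient.eq_zero_iff_mem.trans
      ((F.exact_zero (x ∘ Fintype.equivFin _)).trans ⟨?_, ?_⟩)
    · rintro ⟨y, hy⟩
      refine ⟨y ∘ (Fintype.equivFin _).symm, ?_⟩
      rw [mulVecLin_apply, submatrix_mulVec_equiv]
      ext r
      simp [Function.comp_assoc, hy]
    · rintro ⟨y, rfl⟩
      refine ⟨y ∘ Fintype.equivFin _, ?_⟩
      rw [mulVecLin_apply, submatrix_mulVec_equiv]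
      ext r
      simp
  exact_succ i x := by
    have h := F.exact_succ i (x ∘ Fintype.equivFin _)
    rw [mulVecLin_apply, submatrix_mulVec_equiv, Equiv.symm_symm]
    refine Iff.trans ⟨fun h0 => ?_, fun h0 => ?_⟩ (h.trans ⟨?_, ?_⟩)
    · ext r
      simpa using congrFun h0 (Fintype.equivFin _ r)
    · rw [h0]
      rfl
    · rintro ⟨y, hy⟩
      refine ⟨y ∘ (Fintype.equivFin _).symm, ?_⟩
      rw [mulVecLin_apply, submatrix_mulVec_equiv]
      ext r
      simp [Function.comp_assoc, hy]
    · rintro ⟨y, rfl⟩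
      refine ⟨y ∘ Fintype.equivFin _, ?_⟩
      rw [mulVecLin_apply, submatrix_mulVec_equiv]
      ext r
      simp

theorem IsMinimalHom.toFreeResolution {F : CyclicResolution I} {deg : ∀ i, F.ι i → ℕ}
    (hF : F.IsMinimalHom H deg) :
    F.toFreeResolution.IsMinimalHom H fun i r => deg i ((Fintype.equivFin _).symm r) where
  hom i := by
    have h : LinearMap.toMatrix' (F.toFreeResolution.d i) = (F.D i).submatrix
        (Fintype.equivFin _).symm (Fintype.equivFin _).symm := LinearMap.toMatrix'_toLin' _
    rw [EntryGrading.IsHomLin, h]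
    exact fun r c => hF.hom i _ _
  ε_hom c := by
    obtain ⟨a, rfl⟩ := (Fintype.equivFin (F.ι 0)).surjective c
    obtain rfl : a = default := Subsingleton.elim _ _
    refine ⟨1, ?_, ?_⟩
    · rw [Equiv.symm_apply_apply, hF.deg_zero]
      exact H.one_mem 0
    · exact congrArg (Ideal.Quotient.mk I) (Pi.single_eq_same _ _)
  mem i x r := by
    change ∑ c, _ * x c ∈ 𝔪
    exact Ideal.sum_mem _ fun c _ => Ideal.mul_mem_right _ _ (hF.mem _ _ _)

/-- The ideal is the image of the homogeneous matrix `F.D 0`, hence homogeneous. For the product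
ideal this supplies the homogeneity that uniqueness requires. -/
theorem IsMinimalHom.π_mem {F : CyclicResolution I} {deg : ∀ i, F.ι i → ℕ}
    (hF : F.IsMinimalHom H deg) (x : R) (hx : x ∈ I) (m : ℕ) : H.π 0 m x ∈ I := by
  obtain ⟨y, hy⟩ := (F.exact_zero fun _ => x).1 hx
  have h := congrFun ((hF.hom 0).proj_mulVec m y) default
  rw [hy, EntryGrading.proj, hF.deg_zero] at h
  rw [h]
  exact F.D_zero_mulVec_mem _ _

/-- The number of basis vectors with given degrees in any minimal resolution. -/
theorem IsMinimalHom.card_eq {F : CyclicResolution I} {deg : ∀ i, F.ι i → ℕ}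
    (hF : F.IsMinimalHom H deg) (h𝔪 : 𝔪 ≠ ⊤) {F' : FreeResolution R (R ⧸ I)}
    {deg' : ∀ i, Fin (F'.rank i) → ℕ} (hF' : F'.IsMinimalHom H deg') (i : ℕ) (P : ℕ → Prop)
    [DecidablePred P] :
    Fintype.card {r // P (deg' i r)} = Fintype.card {r // P (deg i r)} := by
  rw [hF'.card_eq h𝔪 hF.π_mem hF.toFreeResolution]
  exact Fintype.card_congr
    ((Fintype.equivFin (F.ι i)).symm.subtypeEquiv fun r => Iff.rfl)

theorem _root_.Finset.Nat.sum_antidiagonal_eq_sum_Icc_one {M : Type*} [AddCommMonoid M] (n : ℕ)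
    (f : ℕ → ℕ → M) : ∑ p ∈ antidiagonal n, f (p.2 + 1) (p.1 + 1) =
      ∑ i ∈ Icc 1 (n + 1), f i (n + 1 + 1 - i) := by
  refine sum_nbij' (fun p => p.2 + 1) (fun i => (n + 1 - i, i - 1)) ?_ ?_ ?_ ?_ ?_
  · intro p hp
    rw [HasAntidiagonal.mem_antidiagonal] at hp
    rw [mem_Icc]
    lia
  · intro i hi
    rw [mem_Icc] at hi
    rw [HasAntidiagonal.mem_antidiagonal]
    lia
  · rintro ⟨a, b⟩ hp
    rw [HasAntidiagonal.mem_antidiagonal] at hp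
    dsimp at hp ⊢
    congr 1
    lia
  · intro i hi
    rw [mem_Icc] at hi
    dsimp
    lia
  · rintro ⟨a, b⟩ hp
    rw [HasAntidiagonal.mem_antidiagonal] at hp
    dsimp at hp ⊢
    congr 1
    lia

theorem card_totalIndex (F : CyclicResolution J) (G : CyclicResolution I) (n : ℕ) :
    Fintype.card (totalIndex F G (n + 1)) =
      ∑ i ∈ Icc 1 (n + 1), Fintype.card (G.ι i) * Fintype.card (F.ι (n + 1 + 1 - i)) := by
  rw [← Finset.Nat.sum_antidiagonal_eq_sum_Icc_one n
    fun i j => Fintype.card (G.ι i) * Fintype.card (F.ι j)]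
  refine (Fintype.card_sigma (ι := antidiagonal n)).trans ?_
  rw [← sum_coe_sort (antidiagonal n)]
  refine sum_congr rfl fun p _ => ?_
  rw [Fintype.card_prod, mul_comm]

/-- For a fixed pair only `j = g s` contributes. The range suffices since `g s ≤ k` whenever the
degrees add up to `k`, and for such `j` the subtraction `k - j` is not truncated. -/
theorem _root_.Fintype.card_add_eq {α β : Type*} [Fintype α] [Fintype β] (f : α → ℕ) (g : β → ℕ)
    (k : ℕ) : Fintype.card {x : α × β // f x.1 + g x.2 = k} =
      ∑ j ∈ range (k + 1), Fintype.card {s // g s = j} * Fintype.card {r // f r = k - j} := by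
  simp only [Fintype.card_subtype, card_filter, Fintype.sum_prod_type, sum_mul_sum]
  symm
  refine sum_comm.trans ((sum_congr rfl fun s _ => sum_comm).trans
    (sum_comm.trans (sum_congr rfl fun r _ => sum_congr rfl fun s _ => ?_)))
  simp only [ite_mul, one_mul, zero_mul]
  rw [sum_ite_eq (range (k + 1)) (g s)]
  simp only [mem_range]
  split_ifs <;> lia

theorem card_totalDeg_eq {F : CyclicResolution J} {G : CyclicResolution I}
    (degF : ∀ i, F.ι i → ℕ) (degG : ∀ i, G.ι i → ℕ) (n k : ℕ) :
    Fintype.card {a // totalDeg degF degG (n + 1) a = k} =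
      ∑ i ∈ Icc 1 (n + 1), ∑ j ∈ range (k + 1), Fintype.card {s // degG i s = j} *
        Fintype.card {r // degF (n + 1 + 1 - i) r = k - j} := by
  rw [← Finset.Nat.sum_antidiagonal_eq_sum_Icc_one n fun i i' => ∑ j ∈ range (k + 1),
    Fintype.card {s // degG i s = j} * Fintype.card {r // degF i' r = k - j},
    ← sum_coe_sort (antidiagonal n)]
  simp only [← Fintype.card_add_eq]
  rw [← Fintype.card_sigma]
  exact Fintype.card_congr
    { toFun := fun a => ⟨a.1.1, a.1.2, a.2⟩
      invFun := fun a => ⟨⟨a.1, a.2.1⟩, a.2.2⟩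
      left_inv := fun _ => rfl
      right_inv := fun _ => rfl }

end CyclicResolution

/-! ### The two instances: local rings and standard graded algebras -/

namespace EntryGrading

/-- The grading of a local ring that is concentrated in degree zero. -/
def ofIsLocalRing (R : Type u) [CommRing R] [IsLocalRing R] :
    EntryGrading R (IsLocalRing.maximalIdeal R) where
  hom a b := if a = b then ⊤ else ⊥
  π a b := if a = b then AddMonoidHom.id R else 0
  one_mem a := by simp
  mul_mem {a b c x y} hx hy := by
    split_ifs at hx hy ⊢ <;> simp_all
  add_right_mem {a b x} c hx := by
    simpa using hx
  π_mem a b x := by split_ifs <;> simp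
  π_of_mem {a b x} hx := by split_ifs at hx ⊢ <;> simp_all
  π_mul {a b x} c y hx := by
    rcases eq_or_ne a b with rfl | h
    · split_ifs <;> simp
    · have hx : x = 0 := by simpa [h] using hx
      simp [hx]
  sum_π a x := by
    refine ⟨a + 1, fun n hn => ?_⟩
    rw [sum_eq_single a]
    · simp
    · intro m _ hm
      simp [hm.symm]
    · intro h
      simp at h
      lia
  mem_of_ne {a b x} h hx := by
    have hx : x = 0 := by simpa [h] using hx
    simp [hx]
  isUnit_π {x} a hx := by
    simpa using hx

variable {K : Type v} [Field K] {R : Type u} [CommRing R] [Algebra K R]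
  (𝒜 : ℕ → Submodule K R) [GradedAlgebra 𝒜]

/-- The entries of homogeneous matrices over a standard graded algebra. -/
def ofIsStandardGraded (h𝒜 : IsStandardGraded 𝒜) :
    EntryGrading R (HomogeneousIdeal.irrelevant 𝒜).toIdeal where
  hom a b := if a ≤ b then (𝒜 (b - a)).toAddSubgroup else ⊥
  π a b := if a ≤ b then GradedRing.proj 𝒜 (b - a) else 0
  one_mem a := by
    simpa using SetLike.GradedOne.one_mem
  mul_mem {a b c x y} hx hy := by
    rcases le_or_gt a b with hab | hab
    swap
    · have hx : x = 0 := by simpa [hab.not_ge] using hx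
      simp [hx]
    rcases le_or_gt b c with hbc | hbc
    swap
    · have hy : y = 0 := by simpa [hbc.not_ge] using hy
      simp [hy]
    rw [if_pos hab] at hx
    rw [if_pos hbc] at hy
    rw [if_pos (hab.trans hbc), ← Nat.sub_add_sub_cancel hbc hab, add_comm]
    exact SetLike.GradedMul.mul_mem (A := 𝒜) hx hy
  add_right_mem {a b x} c hx := by
    rw [Nat.add_sub_add_right]
    simpa only [Nat.add_le_add_iff_right] using hx
  π_mem a b x := by
    split_ifs
    · exact SetLike.coe_mem (DirectSum.decompose 𝒜 x _)
    · exact zero_mem _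
  π_of_mem {a b x} hx := by
    split_ifs at hx ⊢
    · exact DirectSum.decompose_of_mem_same 𝒜 hx
    · simp_all
  π_mul {a b x} c y hx := by
    rcases le_or_gt a b with hab | hab
    swap
    · have hx : x = 0 := by simpa [hab.not_ge] using hx
      simp [hx]
    rw [if_pos hab] at hx
    rcases le_or_gt b c with hbc | hbc
    · rw [if_pos hbc, if_pos (hab.trans hbc)]
      refine (DirectSum.coe_decompose_mul_of_left_mem_of_le 𝒜 hx (by lia)).trans ?_
      rw [Nat.sub_sub_sub_cancel_right hab]
      rfl
    · rw [if_neg hbc.not_ge]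
      split_ifs
      · refine (DirectSum.coe_decompose_mul_of_left_mem_of_not_le 𝒜 hx (by lia)).trans ?_
        simp
      · simp
  sum_π a x := by
    classical
    -- Index `m` picks out the component of degree `m - a`: indices below `a` contribute zero, and
    -- the bound reaches the top degree of `x`.
    refine ⟨a + ((DirectSum.decompose 𝒜 x).support.sup id + 1), fun n hn => ?_⟩
    obtain ⟨n, rfl⟩ : ∃ k, n = a + k := ⟨n - a, by lia⟩
    rw [sum_range_add, sum_eq_zero, zero_add]
    · conv_rhs => rw [← DirectSum.sum_support_decompose 𝒜 x]
      simp only [Nat.le_add_right, if_true, Nat.add_sub_cancel_left]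
      refine (sum_subset (fun i hi => ?_) fun i _ hi => ?_).symm
      · have := le_sup (f := id) hi
        dsimp at this
        rw [mem_range]
        lia
      · have : DirectSum.decompose 𝒜 x i = 0 := by simpa using hi
        rw [GradedRing.proj_apply, this]
        rfl
    · intro m hm
      rw [mem_range] at hm
      simp [hm.not_ge]
  mem_of_ne {a b x} h hx := by
    refine (HomogeneousIdeal.mem_irrelevant_iff 𝒜 x).2 ?_
    split_ifs at hx with hab
    · exact DirectSum.decompose_of_mem_ne 𝒜 hx (by lia)
    · have hx : x = 0 := by simpa using hx
      simp [hx]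
  isUnit_π {x} a hx := by
    replace hx : ¬ GradedRing.proj 𝒜 0 x = 0 :=
      fun h => hx ((HomogeneousIdeal.mem_irrelevant_iff 𝒜 x).2 h)
    rw [if_pos le_rfl, Nat.sub_self]
    -- The constant term is a scalar from `K`, nonzero because `x` is outside the irrelevant ideal,
    -- hence a unit.
    have h1 : GradedRing.proj 𝒜 0 x ∈ (𝒜 0 : Set R) := SetLike.coe_mem (DirectSum.decompose 𝒜 x _)
    rw [h𝒜.degree_zero] at h1
    obtain ⟨c, hc⟩ := h1
    rw [← hc]
    refine (IsUnit.mk0 c ?_).map _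
    rintro rfl
    rw [map_zero] at hc
    exact hx hc.symm

variable {𝒜}

theorem mem_hom_ofIsStandardGraded_iff (h𝒜 : IsStandardGraded 𝒜) {a b : ℕ} {x : R} :
    x ∈ (ofIsStandardGraded 𝒜 h𝒜).hom a b ↔ x = 0 ∨ ∃ c, c + a = b ∧ x ∈ 𝒜 c := by
  change x ∈ (if a ≤ b then (𝒜 (b - a)).toAddSubgroup else ⊥) ↔ _
  split_ifs with h
  · constructor
    · exact fun hx => Or.inr ⟨b - a, by lia, hx⟩
    · rintro (rfl | ⟨c, rfl, hx⟩)
      · exact zero_mem _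
      · rwa [Nat.add_sub_cancel]
  · constructor
    · exact fun hx => Or.inl hx
    · rintro (rfl | ⟨c, rfl, hx⟩)
      · exact zero_mem _
      · lia

end EntryGrading

/-! ### Translation to the Betti numbers of the statement -/

namespace FreeResolution

theorem isMinimal_iff {R : Type u} [CommRing R] {M : Type w} [AddCommGroup M] [Module R M]
    {F : FreeResolution R M} {𝔪 : Ideal R} : F.IsMinimal 𝔪 ↔ ∀ i x r, F.d i x r ∈ 𝔪 := by
  have key : ∀ n (x : Fin n → R), x ∈ 𝔪 • (⊤ : Submodule R (Fin n → R)) ↔ ∀ r, x r ∈ 𝔪 := by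
    intro n x
    constructor
    · intro hx r
      refine Submodule.smul_induction_on (p := fun y => y r ∈ 𝔪) hx (fun a ha y _ => ?_)
        fun y z hy hz => Ideal.add_mem _ hy hz
      exact Ideal.mul_mem_right _ _ ha
    · intro hx
      rw [pi_eq_sum_univ' x]
      exact Submodule.sum_mem _ fun r _ => Submodule.smul_mem_smul (hx r) trivial
  constructor
  · exact fun h i x => (key _ _).1 (h i ⟨x, rfl⟩)
  · rintro h i _ ⟨x, rfl⟩
    exact (key _ _).2 (h i x)

/-- With all degrees equal to zero every entry is allowed, so homogeneity is vacuous. -/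
theorem isMinimalHom_ofIsLocalRing_iff {R : Type u} [CommRing R] [IsLocalRing R] {I : Ideal R}
    {F : FreeResolution R (R ⧸ I)} :
    F.IsMinimalHom (EntryGrading.ofIsLocalRing R) (fun _ _ => 0) ↔
      F.IsMinimal (IsLocalRing.maximalIdeal R) := by
  rw [isMinimal_iff]
  refine ⟨fun h => h.mem, fun h => ⟨fun i r c => ?_, fun c => ?_, h⟩⟩
  · exact AddSubgroup.mem_top _
  · obtain ⟨x, hx⟩ := Ideal.Quotient.mk_surjective (F.ε (Pi.single c 1))
    exact ⟨x, AddSubgroup.mem_top _, hx.symm⟩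

theorem isMinimalHom_ofIsStandardGraded_iff {K : Type v} [Field K] {R : Type u} [CommRing R]
    [Algebra K R] {𝒜 : ℕ → Submodule K R} [GradedAlgebra 𝒜] (h𝒜 : IsStandardGraded 𝒜)
    {I : Ideal R} {F : FreeResolution R (R ⧸ I)} {deg : ∀ i, Fin (F.rank i) → ℕ} :
    F.IsMinimalHom (EntryGrading.ofIsStandardGraded 𝒜 h𝒜) deg ↔
      F.IsGraded 𝒜 (quotientGrading 𝒜 I) deg ∧
        F.IsMinimal (HomogeneousIdeal.irrelevant 𝒜).toIdeal := by
  rw [isMinimal_iff]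
  have hε : ∀ c, (∃ x ∈ (EntryGrading.ofIsStandardGraded 𝒜 h𝒜).hom 0 (deg 0 c),
      F.ε (Pi.single c 1) = Ideal.Quotient.mk I x) ↔
      F.ε (Pi.single c 1) ∈ quotientGrading 𝒜 I (deg 0 c) := fun c =>
    ⟨fun ⟨x, hx, h⟩ => ⟨x, hx, h.symm⟩, fun ⟨x, hx, h⟩ => ⟨x, hx, h.symm⟩⟩
  constructor
  · exact fun h => ⟨⟨fun i c r => (EntryGrading.mem_hom_ofIsStandardGraded_iff h𝒜).1 (h.hom i r c),
      fun c => (hε c).1 (h.ε_hom c)⟩, h.mem⟩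
  · exact fun h => ⟨fun i r c => (EntryGrading.mem_hom_ofIsStandardGraded_iff h𝒜).2
      (h.1.d_homogeneous i c r), fun c => (hε c).2 (h.1.ε_homogeneous c), h.2⟩

end FreeResolution

namespace EntryGrading

variable {R : Type u} [CommRing R] {I J 𝔪 : Ideal R} (H : EntryGrading R 𝔪)

/-- An element of `I` outside `𝔪` would have a unit as its component of degree 0, and that component
lies in `I`. -/
theorem le_of_ne_top (hI : I ≠ ⊤) (hhom : ∀ x ∈ I, ∀ m, H.π 0 m x ∈ I) : I ≤ 𝔪 := by
  intro x hx
  by_contra h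
  exact hI (Ideal.eq_top_of_isUnit_mem _ (hhom x hx 0) (H.isUnit_π 0 h))

/-- Minimal resolutions of `R ⧸ J`, of `R ⧸ I` and of `R ⧸ J * I`. -/
theorem exists_total [IsNoetherianRing R] (hI : I ≠ ⊤) (hIhom : ∀ x ∈ I, ∀ m, H.π 0 m x ∈ I)
    (hJ : J ≠ ⊤) (hJhom : ∀ x ∈ J, ∀ m, H.π 0 m x ∈ J) (h : I.TorIndependent J) :
    ∃ (F : CyclicResolution J) (degF : ∀ i, F.ι i → ℕ) (G : CyclicResolution I)
      (degG : ∀ i, G.ι i → ℕ) (hF : F.IsExactMod I), F.IsMinimalHom H degF ∧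
      G.IsMinimalHom H degG ∧
      (CyclicResolution.total F G hF).IsMinimalHom H (CyclicResolution.totalDeg degF degG) := by
  obtain ⟨F, degF, hF⟩ := CyclicResolution.exists_isMinimalHom H (H.le_of_ne_top hJ hJhom) hJhom
  obtain ⟨G, degG, hG⟩ := CyclicResolution.exists_isMinimalHom H (H.le_of_ne_top hI hIhom) hIhom
  exact ⟨F, degF, G, degG, F.isExactMod h, hF, hG, hF.total hG _⟩

end EntryGrading

theorem CyclicResolution.IsMinimalHom.localBetti_eq {R : Type u} [CommRing R] [IsLocalRing R]
    {I : Ideal R} {F : CyclicResolution I} {deg : ∀ i, F.ι i → ℕ}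
    (hF : F.IsMinimalHom (EntryGrading.ofIsLocalRing R) deg) (i : ℕ) :
    localBetti R (R ⧸ I) i = Fintype.card (F.ι i) := by
  have h : {b : ℕ | ∃ F : FreeResolution R (R ⧸ I),
      F.IsMinimal (IsLocalRing.maximalIdeal R) ∧ F.rank i = b} = {Fintype.card (F.ι i)} := by
    refine Set.eq_singleton_iff_unique_mem.2 ⟨⟨F.toFreeResolution,
      FreeResolution.isMinimal_iff.2 hF.toFreeResolution.mem, rfl⟩, ?_⟩
    rintro _ ⟨F', hF', rfl⟩
    simpa using hF.card_eq Ideal.IsPrime.ne_top'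
      (FreeResolution.isMinimalHom_ofIsLocalRing_iff.2 hF') i fun _ => True
  rw [localBetti, h, csInf_singleton]

section StandardGraded

variable {K : Type v} [Field K] {R : Type u} [CommRing R] [Algebra K R]
  {𝒜 : ℕ → Submodule K R} [GradedAlgebra 𝒜] {h𝒜 : IsStandardGraded 𝒜} {I : Ideal R}
  {F : CyclicResolution I} {deg : ∀ i, F.ι i → ℕ}

theorem irrelevant_ne_top [Nontrivial R] : (HomogeneousIdeal.irrelevant 𝒜).toIdeal ≠ ⊤ := by
  rw [Ideal.ne_top_iff_one]
  intro h
  refine one_ne_zero (α := R) (Eq.trans ?_ ((HomogeneousIdeal.mem_irrelevant_iff 𝒜 1).1 h))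
  exact (DirectSum.decompose_of_mem_same 𝒜 SetLike.GradedOne.one_mem).symm

theorem CyclicResolution.IsMinimalHom.totalBetti_eq [Nontrivial R]
    (hF : F.IsMinimalHom (EntryGrading.ofIsStandardGraded 𝒜 h𝒜) deg) (i : ℕ) :
    totalBetti 𝒜 (quotientGrading 𝒜 I) i = Fintype.card (F.ι i) := by
  have h : {b : ℕ | ∃ (F : FreeResolution R (R ⧸ I)) (deg : ∀ i : ℕ, Fin (F.rank i) → ℕ),
      F.IsGraded 𝒜 (quotientGrading 𝒜 I) deg ∧
        F.IsMinimal (HomogeneousIdeal.irrelevant 𝒜).toIdeal ∧ F.rank i = b} =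
      {Fintype.card (F.ι i)} := by
    have h0 := (FreeResolution.isMinimalHom_ofIsStandardGraded_iff h𝒜).1 hF.toFreeResolution
    refine Set.eq_singleton_iff_unique_mem.2 ⟨⟨F.toFreeResolution, _, h0.1, h0.2, rfl⟩, ?_⟩
    rintro _ ⟨F', deg', hF', hm, rfl⟩
    simpa using hF.card_eq irrelevant_ne_top
      ((FreeResolution.isMinimalHom_ofIsStandardGraded_iff h𝒜).2 ⟨hF', hm⟩) i fun _ => True
  rw [totalBetti, h, csInf_singleton]

theorem CyclicResolution.IsMinimalHom.gradedBetti_eq [Nontrivial R]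
    (hF : F.IsMinimalHom (EntryGrading.ofIsStandardGraded 𝒜 h𝒜) deg) (i j : ℕ) :
    gradedBetti 𝒜 (quotientGrading 𝒜 I) i j = Fintype.card {r // deg i r = j} := by
  have h0 := (FreeResolution.isMinimalHom_ofIsStandardGraded_iff h𝒜).1 hF.toFreeResolution
  have h : {b : ℕ | ∃ (F : FreeResolution R (R ⧸ I)) (deg : ∀ i : ℕ, Fin (F.rank i) → ℕ),
      F.IsGraded 𝒜 (quotientGrading 𝒜 I) deg ∧
        F.IsMinimal (HomogeneousIdeal.irrelevant 𝒜).toIdeal ∧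
        (Finset.univ.filter fun r : Fin (F.rank i) => deg i r = j).card = b} =
      {Fintype.card {r // deg i r = j}} := by
    have key : ∀ {F' : FreeResolution R (R ⧸ I)} {deg' : ∀ i : ℕ, Fin (F'.rank i) → ℕ},
        F'.IsMinimalHom (EntryGrading.ofIsStandardGraded 𝒜 h𝒜) deg' →
        (Finset.univ.filter fun r : Fin (F'.rank i) => deg' i r = j).card =
          Fintype.card {r // deg i r = j} := fun hF' => by
      rw [← Fintype.card_subtype]
      exact hF.card_eq irrelevant_ne_top hF' i (· = j)
    refine Set.eq_singleton_iff_unique_mem.2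
      ⟨⟨F.toFreeResolution, _, h0.1, h0.2, key hF.toFreeResolution⟩, ?_⟩
    rintro _ ⟨F', deg', hF', hm, rfl⟩
    exact key ((FreeResolution.isMinimalHom_ofIsStandardGraded_iff h𝒜).2 ⟨hF', hm⟩)
  rw [gradedBetti, h, csInf_singleton]

end StandardGraded

theorem corollary3p4 :
    -- noetherian local rings
    (∀ (R : Type u) [CommRing R] [IsLocalRing R] [IsNoetherianRing R] (I J : Ideal R),
      I ≠ ⊤ → J ≠ ⊤ → I.TorIndependent J →
      ∀ ℓ : ℕ, 0 < ℓ →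
        localBetti R (R ⧸ I * J) ℓ =
          ∑ i ∈ Finset.Icc 1 ℓ, localBetti R (R ⧸ I) i * localBetti R (R ⧸ J) (ℓ + 1 - i)) ∧
    -- noetherian standard graded rings
    (∀ (K : Type v) [Field K] (R : Type u) [CommRing R] [Algebra K R] [IsNoetherianRing R]
      (𝒜 : ℕ → Submodule K R) [GradedAlgebra 𝒜], IsStandardGraded 𝒜 →
      ∀ I J : Ideal R, I.IsHomogeneous 𝒜 → J.IsHomogeneous 𝒜 →
      I ≠ ⊤ → J ≠ ⊤ → I.TorIndependent J →
      ∀ ℓ : ℕ, 0 < ℓ →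
        (totalBetti 𝒜 (quotientGrading 𝒜 (I * J)) ℓ =
          ∑ i ∈ Finset.Icc 1 ℓ, totalBetti 𝒜 (quotientGrading 𝒜 I) i *
            totalBetti 𝒜 (quotientGrading 𝒜 J) (ℓ + 1 - i)) ∧
        ∀ k : ℕ, gradedBetti 𝒜 (quotientGrading 𝒜 (I * J)) ℓ k =
          ∑ i ∈ Finset.Icc 1 ℓ, ∑ j ∈ Finset.range (k + 1),
            gradedBetti 𝒜 (quotientGrading 𝒜 I) i j *
              gradedBetti 𝒜 (quotientGrading 𝒜 J) (ℓ + 1 - i) (k - j)) := by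
  refine ⟨fun R _ _ _ I J hI hJ h ℓ hℓ => ?_,
    fun K _ R _ _ _ 𝒜 _ h𝒜 I J hIhom hJhom hI hJ h ℓ hℓ => ?_⟩
  · obtain ⟨n, rfl⟩ := Nat.exists_eq_succ_of_ne_zero hℓ.ne'
    have hhom : ∀ I : Ideal R, ∀ x ∈ I, ∀ m, (EntryGrading.ofIsLocalRing R).π 0 m x ∈ I := by
      intro I x hx m
      change (if 0 = m then AddMonoidHom.id R else 0) x ∈ I
      split_ifs
      · exact hx
      · exact zero_mem _
    obtain ⟨F, degF, G, degG, hFI, hF, hG, hT⟩ :=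
      (EntryGrading.ofIsLocalRing R).exists_total hI (hhom I) hJ (hhom J) h
    -- The total resolution is built for `J * I`, with the resolution of `R ⧸ J` as first factor.
    rw [mul_comm I J, hT.localBetti_eq]
    simp only [hF.localBetti_eq, hG.localBetti_eq]
    exact CyclicResolution.card_totalIndex F G n
  · obtain ⟨n, rfl⟩ := Nat.exists_eq_succ_of_ne_zero hℓ.ne'
    have : Nontrivial R := by
      by_contra hR
      rw [not_nontrivial_iff_subsingleton] at hR
      exact hI (Subsingleton.elim _ _)
    have hhom : ∀ I : Ideal R, I.IsHomogeneous 𝒜 →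
        ∀ x ∈ I, ∀ m, (EntryGrading.ofIsStandardGraded 𝒜 h𝒜).π 0 m x ∈ I :=
      fun I hI x hx m => hI m hx
    obtain ⟨F, degF, G, degG, hFI, hF, hG, hT⟩ :=
      (EntryGrading.ofIsStandardGraded 𝒜 h𝒜).exists_total hI (hhom I hIhom) hJ (hhom J hJhom) h
    rw [mul_comm I J]
    refine ⟨?_, fun k => ?_⟩
    · rw [hT.totalBetti_eq]
      simp only [hF.totalBetti_eq, hG.totalBetti_eq]
      exact CyclicResolution.card_totalIndex F G n
    · rw [hT.gradedBetti_eq]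
      simp only [hF.gradedBetti_eq, hG.gradedBetti_eq]
      exact CyclicResolution.card_totalDeg_eq degF degG n k
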